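/- **Setting.** All spaces are finite-dimensional. A superoperator is a complex-linear map on the $D\times D$ complex matrices. A Lindbladian is a superoperator of the form $$\mathcal L(X)=-\mathrm i[H,X]+\sum_{\nu}\Big(J_\nu XJ_\nu^\dagger-\tfrac12\{J_\nu^\dagger J_\nu,X\}\Big)$$ with a Hermitian matrix $H$ and finitely many matrices $J_\nu$. The diamond norm is $\|\Phi\|_\diamond=\max_{\|X\|_1\le1}\|(\Phi\otimes\mathrm{id}_D)(X)\|_1$, where $\|X\|_1=\mathrm{Tr}\sqrt{X^\dagger X}$. For superoperators $\mathcal L_1,\dots,\mathcal L_m$, with $\mathcal L=\sum_{j=1}^m\mathcal L_j$, put $$\mathcal S(t)=e^{t\mathcal L_1/2}\cdots e^{t\mathcal L_m/2}\,e^{t\mathcal L_m/2}\cdots e^{t\mathcal L_1/2},\qquad \alpha^{(3)}_{\rm comm}=\sum_{j_1,j_2,j_3=1}^m\big\|[\mathcal L_{j_1},[\mathcal L_{j_2},\mathcal L_{j_3}]]\big\|_\diamond .$$ **Theorem (Channel approximation).** (a) There is a universal constant $C>0$ such that for every dimension $D$, all Lindbladians $\mathcal L_1,\dots,\mathcal L_m$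 with sum $\mathcal L$, every $t>0$ and every $\varepsilon>0$ there is an integer $$1\le r_0\le\max\Big\{1,\;C\,\frac{(\alpha^{(3)}_{\rm comm})^{1/2}\,t^{3/2}}{\sqrt\varepsilon}\Big\}$$ such that $\|\mathcal S(t/r)^r-e^{t\mathcal L}\|_\diamond\le\varepsilon$ for every integer $r\ge r_0$. (b) Consider $N$ sites with arbitrary finite local dimensions. A $(\Gamma,k)$-local Lindbladian is $\mathcal L=\sum_\mu\mathcal H_\mu+\sum_\nu\mathcal D_\nu$ (finite sums) with $\mathcal H_\mu(X)=-\mathrm i[H_\mu,X]$ and $\mathcal D_\nu(X)=L_\nu XL_\nu^\dagger-\frac12\{L_\nu^\dagger L_\nu,X\}$, where each $H_\mu$ is Hermitian and supported on at most $k$ sites and each $L_\nu=\sum_{\gamma=1}^{\Gamma}d_{\nu,\gamma}$ with every $d_{\nu,\gamma}$ supported on at most $k$ sites. Let $(\mathcal K_v)_v$ be the family of all $\mathcal H_\mu$ and all superoperators $X\mapsto d_{\nu,\gamma_1}Xd_{\nu,\gamma_2}^\dagger-\frac12\{d_{\nu,\gamma_2}^\dagger d_{\nu,\gamma_1},X\}$.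 The Lindbladian is $g$-extensive if $\sum_{v:\,\mathrm{supp}(\mathcal K_v)\ni j}\|\mathcal K_v\|_\diamond\le g$ for every site $j$, where $\mathrm{supp}(\mathcal K)$ is the set of sites on which $\mathcal K$ acts nontrivially, that is, of the sites $j$ for which $\mathcal K$ is not of the form $\mathcal K'\otimes\mathrm{id}_j$. There is a universal constant $C>0$ such that for every $(\Gamma,k)$-local and $g$-extensive Lindbladian on $N$ sites, for the decomposition of $\mathcal L$ into the summands $\mathcal H_\mu$ and $\mathcal D_\nu$, taken in any order, and for all $t>0$ and $\varepsilon>0$ there is an integer $$1\le r_0\le\max\Big\{1,\;C\,\frac{\sqrt N\,k\,(gt)^{3/2}}{\sqrt\varepsilon}\Big\}$$ such that $\|\mathcal S(t/r)^r-e^{t\mathcal L}\|_\diamond\le\varepsilon$ for every integer $r\ge r_0$. -/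

import Mathlib

noncomputable section

/-- Superoperators: complex-linear maps on `n × n` complex matrices. -/
abbrev Superop (n : Type) [Fintype n] [DecidableEq n] : Type :=
  Module.End ℂ (Matrix n n ℂ)

section General

variable {n : Type} [Fintype n] [DecidableEq n]

/-- The superoperator `X ↦ A X B`. -/
def sandwich (A B : Matrix n n ℂ) : Superop n :=
  LinearMap.mulLeftRight ℂ (A, B)

theorem sandwich_apply (A B X : Matrix n n ℂ) : sandwich A B X = A * X * B := by
  simp [sandwich]

/-- The coherent term `X ↦ -i [H, X]`. -/
def coherentTerm (H : Matrix n n ℂ) : Superop n :=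
  (-Complex.I) • (sandwich H 1 - sandwich 1 H)

/-- The superoperator `X ↦ A X B† - (1/2) {B† A, X}`. -/
def crossDissipator (A B : Matrix n n ℂ) : Superop n :=
  sandwich A B.conjTranspose
    - (1 / 2 : ℂ) • (sandwich (B.conjTranspose * A) 1 + sandwich 1 (B.conjTranspose * A))

/-- The dissipator `X ↦ J X J† - (1/2) {J† J, X}` of the jump operator `J`. -/
def dissipator (J : Matrix n n ℂ) : Superop n := crossDissipator J J

theorem coherentTerm_apply (H X : Matrix n n ℂ) :
    coherentTerm H X = -Complex.I • (H * X - X * H) := by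
  simp [coherentTerm, sandwich_apply]

theorem dissipator_apply (J X : Matrix n n ℂ) :
    dissipator J X = J * X * J.conjTranspose
      - (1 / 2 : ℂ) • (J.conjTranspose * J * X + X * (J.conjTranspose * J)) := by
  simp [dissipator, crossDissipator, sandwich_apply]

/-- Lindbladians (generators in Gorini-Kossakowski-Sudarshan-Lindblad form). -/
def IsLindbladian (L : Superop n) : Prop :=
  ∃ (H : Matrix n n ℂ) (p : ℕ) (J : Fin p → Matrix n n ℂ),
    H.IsHermitian ∧ L = coherentTerm H + ∑ ν, dissipator (J ν)

/-- The trace norm `Tr √(X† X)`: the sum of the square roots of the eigenvalues of `X† X`. -/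
def traceNorm (X : Matrix n n ℂ) : ℝ :=
  ∑ i, √((Matrix.isHermitian_conjTranspose_mul_self X).eigenvalues i)

/-- `Φ ⊗ id`, with an ancilla of the same dimension as the system, applied to `X`. -/
def ampliation (Φ : Superop n) (X : Matrix (n × n) (n × n) ℂ) : Matrix (n × n) (n × n) ℂ :=
  Matrix.of fun a b => Φ (Matrix.of fun i j => X (i, a.2) (j, b.2)) a.1 b.1

/-- The diamond norm: the `1 → 1` norm of `Φ ⊗ id` for the trace norm. -/
def diamondNorm (Φ : Superop n) : ℝ :=
  sSup {c : ℝ | ∃ X : Matrix (n × n) (n × n) ℂ,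
    traceNorm X ≤ 1 ∧ c = traceNorm (ampliation Φ X)}

section Exponential

open scoped Matrix.Norms.L2Operator

/-- The evolution `e^{tL}`, given by the exponential series. The exponential is taken in the algebra
of continuous linear maps; every linear map is continuous here, and the norm put on matrices plays
no role, since all norms in finite dimension are equivalent. -/
def evolution (L : Superop n) (t : ℝ) : Superop n :=
  (NormedSpace.exp (LinearMap.toContinuousLinearMap ((t : ℂ) • L) :
    Matrix n n ℂ →L[ℂ] Matrix n n ℂ) : Matrix n n ℂ →L[ℂ] Matrix n n ℂ)

end Exponential

/-- The second-order product formula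
`e^{tL₁/2} ⋯ e^{tL_m/2} e^{tL_m/2} ⋯ e^{tL₁/2}` (the product is composition). -/
def productFormula {m : ℕ} (L : Fin m → Superop n) (t : ℝ) : Superop n :=
  (List.ofFn fun j => evolution (L j) (t / 2)).prod *
    (List.ofFn fun j => evolution (L j) (t / 2)).reverse.prod

/-- The sum of the diamond norms of all grade-3 right-nested commutators of the summands. -/
def alphaComm3 {m : ℕ} (L : Fin m → Superop n) : ℝ :=
  ∑ j₁, ∑ j₂, ∑ j₃, diamondNorm ⁅L j₁, ⁅L j₂, L j₃⁆⁆

/-- The diamond-norm error of `r` steps of the second-order product formula for time `t`. -/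
def trotterError {m : ℕ} (L : Fin m → Superop n) (t : ℝ) (r : ℕ) : ℝ :=
  diamondNorm (productFormula L (t / r) ^ r - evolution (∑ j, L j) t)

end General

section Local

variable {N : ℕ} {d : Fin N → ℕ}

/-- Labels of the product basis of the sites in `S`, where site `i` has local dimension `d i`. -/
abbrev Config (d : Fin N → ℕ) (S : Finset (Fin N)) : Type := ∀ i : S, Fin (d i)

/-- Labels of the product basis of the whole lattice. -/
abbrev FullConfig (d : Fin N → ℕ) : Type := ∀ i : Fin N, Fin (d i)

/-- `X ⊗ Y`, with `X` acting on the sites in `S` and `Y` on the sites outside `S`. -/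
def tensorAt (S : Finset (Fin N)) (X : Matrix (Config d S) (Config d S) ℂ)
    (Y : Matrix (Config d Sᶜ) (Config d Sᶜ) ℂ) : Matrix (FullConfig d) (FullConfig d) ℂ :=
  Matrix.of fun a b => X (S.restrict a) (S.restrict b) * Y (Sᶜ.restrict a) (Sᶜ.restrict b)

/-- The operator `A` is supported on `S`: `A = A' ⊗ 1`. -/
def OpSupportedOn (A : Matrix (FullConfig d) (FullConfig d) ℂ) (S : Finset (Fin N)) : Prop :=
  ∃ A' : Matrix (Config d S) (Config d S) ℂ, A = tensorAt S A' 1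

/-- The superoperator `K` is supported on `S`: `K = K' ⊗ id`. -/
def SuperopSupportedOn (K : Superop (FullConfig d)) (S : Finset (Fin N)) : Prop :=
  ∃ K' : Superop (Config d S), ∀ (X : Matrix (Config d S) (Config d S) ℂ)
    (Y : Matrix (Config d Sᶜ) (Config d Sᶜ) ℂ), K (tensorAt S X Y) = tensorAt S (K' X) Y

open Classical in
/-- The support of a superoperator: the sites on which it acts nontrivially. -/
def superopSupport (K : Superop (FullConfig d)) : Finset (Fin N) :=
  Finset.univ.filter fun j => ¬ SuperopSupportedOn K {j}ᶜ

/-- A `(Γ, k)`-local Lindbladian on `N` sites: Hamiltonian terms `H μ` and components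
`comp ν γ` of the jump operators, each supported on at most `k` sites. Jump operators with fewer
than `Γ` components are padded with zero components. -/
structure LocalLindbladian (N : ℕ) (d : Fin N → ℕ) (Γ k : ℕ) where
  /-- number of Hamiltonian terms -/
  mC : ℕ
  /-- number of jump operators -/
  mD : ℕ
  /-- Hamiltonian terms -/
  H : Fin mC → Matrix (FullConfig d) (FullConfig d) ℂ
  /-- components of the jump operators -/
  comp : Fin mD → Fin Γ → Matrix (FullConfig d) (FullConfig d) ℂ
  isHermitian_H : ∀ μ, (H μ).IsHermitian
  local_H : ∀ μ, ∃ S : Finset (Fin N), S.card ≤ k ∧ OpSupportedOn (H μ) S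
  local_comp : ∀ ν γ, ∃ S : Finset (Fin N), S.card ≤ k ∧ OpSupportedOn (comp ν γ) S

namespace LocalLindbladian

variable {Γ k : ℕ} (𝓛 : LocalLindbladian N d Γ k)

/-- The jump operators. -/
def jump (ν : Fin 𝓛.mD) : Matrix (FullConfig d) (FullConfig d) ℂ := ∑ γ, 𝓛.comp ν γ

/-- The summands of the Trotter decomposition: one coherent term for each Hamiltonian term and
one dissipator for each jump operator. -/
def term : Fin 𝓛.mC ⊕ Fin 𝓛.mD → Superop (FullConfig d)
  | .inl μ => coherentTerm (𝓛.H μ)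
  | .inr ν => dissipator (𝓛.jump ν)

/-- The summands of the finer decomposition into local superoperators. -/
def localTerm : Fin 𝓛.mC ⊕ (Fin 𝓛.mD × Fin Γ × Fin Γ) → Superop (FullConfig d)
  | .inl μ => coherentTerm (𝓛.H μ)
  | .inr (ν, γ₁, γ₂) => crossDissipator (𝓛.comp ν γ₁) (𝓛.comp ν γ₂)

/-- `g`-extensiveness: at each site, the diamond norms of the local superoperators whose support
contains the site sum to at most `g`. -/
def IsExtensive (g : ℝ) : Prop :=
  ∀ j : Fin N, ∑ v with j ∈ superopSupport (𝓛.localTerm v), diamondNorm (𝓛.localTerm v) ≤ g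

end LocalLindbladian

end Local

end

/-! The diamond norm is an operator norm: `diamondHom` sends superoperators to operators on matrices
with the trace norm, multiplicatively, and `norm_diamondHom` identifies the norms. The error
analysis can therefore be done in a Banach algebra, where a Lindbladian enters only through its
nonpositive logarithmic norm: `1 + s L` is a Kraus map up to O(s²). Nonpositivity is additive and
makes every `exp (s • x)` with `s ≥ 0` a contraction.

Inverse evolutions of dissipative generators need not be contractive, so the splitting error may use
forward evolutions only. In `norm_strang_sub_exp_le` the defect of the differential equation is
written with commutators of exponentials; their first-order parts cancel by symmetry, leaving double
commutators times s². Peeling off the outermost factor, as in `norm_strangProduct_sub_exp_le`,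
handles m summands without a constant growing in m, because the commutators arising at different
levels are distinct terms of the full sum. Telescoping over r steps gives an error of at most t³ α /
r².

For local generators α is bounded by counting. A commutator of sums is at most the sum over the
local pieces; pieces with disjoint supports commute (`lie_eq_zero_of_disjoint_superopSupport`);
extensivity then bounds the weight meeting a given set of sites (`sum_nestedCommutator_le`), so α =
O(N k² g³), independent of Γ. -/

section BanachAlgebra

/-! ### Logarithmic norms and contraction semigroups -/

open NormedSpace Set Filter Topology

variable {A : Type*} [NormedRing A] [NormedAlgebra ℝ A]

/-- The logarithmic norm of `x` is nonpositive: `‖1 + s x‖ ≤ 1 + o(s)` as `s → 0+`. -/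
def LogNormNonpos (x : A) : Prop :=
  ∀ ε : ℝ, 0 < ε → ∀ᶠ s : ℝ in 𝓝[>] 0, ‖1 + s • x‖ ≤ 1 + ε * s

/-- The point `1 + s (x + y)` is the midpoint of `1 + 2s x` and `1 + 2s y`. This easy additivity is
the reason to work with logarithmic norms rather than directly with contractivity of the semigroups.
-/
theorem LogNormNonpos.add {x y : A} (hx : LogNormNonpos x) (hy : LogNormNonpos y) :
    LogNormNonpos (x + y) := by
  intro ε hε
  have hscale : Tendsto (fun s : ℝ => 2 * s) (𝓝[>] 0) (𝓝[>] 0) := by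
    refine tendsto_nhdsWithin_iff.2 ⟨?_, ?_⟩
    · have : Tendsto (fun s : ℝ => 2 * s) (𝓝 0) (𝓝 (2 * 0)) := tendsto_id.const_mul 2
      rw [mul_zero] at this
      exact this.mono_left nhdsWithin_le_nhds
    · filter_upwards [self_mem_nhdsWithin] with s hs
      simpa using hs
  filter_upwards [hscale.eventually (hx (ε / 2) (half_pos hε)),
    hscale.eventually (hy (ε / 2) (half_pos hε))] with s h1 h2
  have key : 1 + s • (x + y) = (1 / 2 : ℝ) • ((1 + (2 * s) • x) + (1 + (2 * s) • y)) := by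
    module
  rw [key, norm_smul, Real.norm_of_nonneg (by norm_num : (0 : ℝ) ≤ 1 / 2)]
  have := norm_add_le (1 + (2 * s) • x) (1 + (2 * s) • y)
  linarith

theorem logNormNonpos_of_norm_le {x : A} {c : ℝ}
    (h : ∀ s : ℝ, 0 ≤ s → ‖1 + s • x‖ ≤ 1 + c * s ^ 2) : LogNormNonpos x := by
  intro ε hε
  have hev : ∀ᶠ s : ℝ in 𝓝[>] 0, s < ε / (|c| + 1) :=
    (eventually_lt_nhds (by positivity)).filter_mono nhdsWithin_le_nhds
  filter_upwards [hev, self_mem_nhdsWithin] with s hs hs0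
  have hs0' : 0 < s := hs0
  rw [lt_div_iff₀ (by positivity)] at hs
  refine (h s hs0'.le).trans ?_
  have h1 : c * s ≤ ε := by nlinarith [le_abs_self c]
  nlinarith

theorem logNormNonpos_zero (h1 : ‖(1 : A)‖ ≤ 1) : LogNormNonpos (0 : A) :=
  logNormNonpos_of_norm_le (c := 0) fun s _ => by simpa using h1

/-- Assuming `‖1‖ ≤ 1` instead of `‖1‖ = 1` keeps the zero algebra, hence empty index types, within
scope. -/
theorem LogNormNonpos.sum {ι : Type*} {x : ι → A} (h1 : ‖(1 : A)‖ ≤ 1) (s : Finset ι)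
    (h : ∀ i ∈ s, LogNormNonpos (x i)) : LogNormNonpos (∑ i ∈ s, x i) :=
  Finset.sum_induction x LogNormNonpos (fun _ _ => LogNormNonpos.add) (logNormNonpos_zero h1) h

omit [NormedAlgebra ℝ A] in
theorem norm_pow_le_pow_of_norm_one_le (h1 : ‖(1 : A)‖ ≤ 1) (x : A) (n : ℕ) :
    ‖x ^ n‖ ≤ ‖x‖ ^ n := by
  rcases Nat.eq_zero_or_pos n with rfl | hn
  · simpa using h1
  · exact norm_pow_le' x hn

variable [CompleteSpace A]

theorem hasDerivAt_exp_smul (x : A) (t : ℝ) :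
    HasDerivAt (fun u : ℝ => exp (u • x)) (exp (t • x) * x) t :=
  hasDerivAt_exp_smul_const x t

theorem hasDerivAt_exp_smul' (x : A) (t : ℝ) :
    HasDerivAt (fun u : ℝ => exp (u • x)) (x * exp (t • x)) t :=
  hasDerivAt_exp_smul_const' x t

theorem exp_add_smul (x : A) (s t : ℝ) : exp ((s + t) • x) = exp (s • x) * exp (t • x) := by
  let _ : NormedAlgebra ℚ A := NormedAlgebra.restrictScalars ℚ ℝ A
  rw [add_smul]
  exact exp_add_of_commute (((Commute.refl x).smul_left s).smul_right t)

theorem exp_nat_mul_smul (x : A) (s : ℝ) (n : ℕ) : exp ((n * s) • x) = exp (s • x) ^ n := by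
  induction n with
  | zero => simp
  | succ n ih => rw [pow_succ, ← ih, ← exp_add_smul]; congr 2; push_cast; ring

theorem exp_smul_mul_self (x : A) (s : ℝ) : exp (s • x) * x = x * exp (s • x) :=
  (hasDerivAt_exp_smul x s).unique (hasDerivAt_exp_smul' x s)

/-- Since `exp (s • x) = 1 + s x + o(s)`, its norm is at most `1 + ε s` for small s. Raising a short
step to a power gives `e^{ε t}`, and ε tends to 0. -/
theorem LogNormNonpos.norm_exp_le {x : A} (h1 : ‖(1 : A)‖ ≤ 1) (hx : LogNormNonpos x)
    {t : ℝ} (ht : 0 ≤ t) : ‖exp (t • x)‖ ≤ 1 := by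
  have small : ∀ ε : ℝ, 0 < ε → ∀ᶠ s : ℝ in 𝓝[>] 0, ‖exp (s • x)‖ ≤ 1 + ε * s := by
    intro ε hε
    have hd := hasDerivAt_exp_smul x 0
    rw [hasDerivAt_iff_isLittleO] at hd
    have hd' := (hd.def (half_pos hε)).filter_mono (nhdsWithin_le_nhds (s := Ioi (0 : ℝ)))
    filter_upwards [hd', hx (ε / 2) (half_pos hε), self_mem_nhdsWithin] with s h2 h3 hs
    have hs' : 0 < s := hs
    simp only [zero_smul, exp_zero, one_mul, sub_zero, Real.norm_of_nonneg hs'.le] at h2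
    have : exp (s • x) = (exp (s • x) - 1 - s • x) + (1 + s • x) := by abel
    rw [this]
    refine (norm_add_le _ _).trans ?_
    linarith
  rcases ht.eq_or_lt with rfl | ht
  · simpa using h1
  have bound : ∀ ε : ℝ, 0 < ε → ‖exp (t • x)‖ ≤ Real.exp (ε * t) := by
    intro ε hε
    have htend : Tendsto (fun n : ℕ => t / ((n : ℝ) + 1)) atTop (𝓝[>] 0) := by
      refine tendsto_nhdsWithin_iff.2 ⟨?_, Eventually.of_forall fun n => ?_⟩
      · have := (tendsto_one_div_add_atTop_nhds_zero_nat (𝕜 := ℝ)).const_mul t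
        simpa [div_eq_mul_inv] using this
      · exact div_pos ht (by positivity)
    obtain ⟨n, hn⟩ := (htend.eventually (small ε hε)).exists
    set s := t / ((n : ℝ) + 1) with hs
    have hst : ((n + 1 : ℕ) : ℝ) * s = t := by
      rw [hs]; push_cast; field_simp
    have hs0 : 0 ≤ s := by positivity
    calc ‖exp (t • x)‖ = ‖exp (s • x) ^ (n + 1)‖ := by rw [← exp_nat_mul_smul, hst]
      _ ≤ ‖exp (s • x)‖ ^ (n + 1) := norm_pow_le' _ n.succ_pos
      _ ≤ Real.exp (ε * s) ^ (n + 1) := by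
          gcongr
          exact hn.trans (by linarith [Real.add_one_le_exp (ε * s)])
      _ = Real.exp (ε * t) := by
          rw [← Real.exp_nat_mul]; congr 1; rw [← hst]; ring
  have hlim : Tendsto (fun ε : ℝ => Real.exp (ε * t)) (𝓝[>] 0) (𝓝 1) := by
    have : Continuous fun ε : ℝ => Real.exp (ε * t) := by fun_prop
    have h := this.tendsto 0
    simp only [zero_mul, Real.exp_zero] at h
    exact h.mono_left nhdsWithin_le_nhds
  exact ge_of_tendsto hlim (by filter_upwards [self_mem_nhdsWithin] with ε hε using bound ε hε)

/-! ### Second-order splitting with forward evolution only -/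

/-- A generator of a contraction semigroup. -/
def IsContractive (x : A) : Prop := ∀ s : ℝ, 0 ≤ s → ‖exp (s • x)‖ ≤ 1

omit [NormedAlgebra ℝ A] [CompleteSpace A] in
theorem norm_mul_mul_le_of_contractive {x y z : A} (hx : ‖x‖ ≤ 1) (hz : ‖z‖ ≤ 1) :
    ‖x * y * z‖ ≤ ‖y‖ := by
  calc ‖x * y * z‖ ≤ ‖x‖ * ‖y‖ * ‖z‖ := norm_mul₃_le
    _ ≤ 1 * ‖y‖ * 1 := by gcongr
    _ = ‖y‖ := by ring

theorem hasDerivAt_conj_exp (x y z : A) (s u : ℝ) :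
    HasDerivAt (fun u : ℝ => exp (u • x) * z * exp ((s - u) • y))
      (exp (u • x) * (x * z - z * y) * exp ((s - u) • y)) u := by
  have h1 := (hasDerivAt_exp_smul x u).mul_const z
  have h2 : HasDerivAt (fun u : ℝ => exp ((s - u) • y)) (-(y * exp ((s - u) • y))) u := by
    have := (hasDerivAt_exp_smul' y (s - u)).scomp u ((hasDerivAt_id u).const_sub s)
    simpa using! this
  convert! h1.mul h2 using 1
  noncomm_ring

/-- Duhamel's formula: the commutator is the integral of `exp (u • x) * ⁅x, z⁆ * exp ((s - u) • x)`
over `[0, s]`, where both exponents are nonnegative multiples of x. -/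
theorem norm_lie_exp_le {x : A} (hx : IsContractive x) (z : A) {s : ℝ} (hs : 0 ≤ s) :
    ‖⁅exp (s • x), z⁆‖ ≤ s * ‖⁅x, z⁆‖ := by
  have := norm_image_sub_le_of_norm_deriv_le_segment' (a := 0) (b := s) (C := ‖⁅x, z⁆‖)
    (fun u _ => (hasDerivAt_conj_exp x x z s u).hasDerivWithinAt)
    (fun u hu => norm_mul_mul_le_of_contractive (hx _ hu.1) (hx _ (by linarith [hu.2])))
    s (right_mem_Icc.2 hs)
  simpa [Ring.lie_def, mul_comm] using this

/-- After the first-order term is subtracted, the Duhamel integrand is itself a commutator with an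
exponential, so the previous bound applies once more. Bounding u by s gives the constant 1 in place
of 1/2. -/
theorem norm_lie_exp_sub_le {x : A} (hx : IsContractive x) (z : A) {s : ℝ} (hs : 0 ≤ s) :
    ‖⁅exp (s • x), z⁆ - s • (⁅x, z⁆ * exp (s • x))‖ ≤ s ^ 2 * ‖⁅x, ⁅x, z⁆⁆‖ := by
  have hder : ∀ u : ℝ, HasDerivAt
      (fun u : ℝ => exp (u • x) * z * exp ((s - u) • x) - u • (⁅x, z⁆ * exp (s • x)))
      (⁅exp (u • x), ⁅x, z⁆⁆ * exp ((s - u) • x)) u := by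
    intro u
    convert! (hasDerivAt_conj_exp x x z s u).sub
      ((hasDerivAt_id u).smul_const (⁅x, z⁆ * exp (s • x))) using 1
    have : exp (s • x) = exp (u • x) * exp ((s - u) • x) := by
      rw [← exp_add_smul]; congr 2; ring
    rw [this, one_smul]
    simp only [Ring.lie_def]
    noncomm_ring
  have := norm_image_sub_le_of_norm_deriv_le_segment' (a := 0) (b := s)
    (C := s * ‖⁅x, ⁅x, z⁆⁆‖) (fun u _ => (hder u).hasDerivWithinAt)
    (fun u hu => by
      refine (norm_mul_le _ _).trans ?_
      calc _ ≤ (u * ‖⁅x, ⁅x, z⁆⁆‖) * 1 :=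
            mul_le_mul (norm_lie_exp_le hx _ hu.1) (hx _ (by linarith [hu.2]))
              (norm_nonneg _) (mul_nonneg hu.1 (norm_nonneg _))
        _ ≤ _ := by rw [mul_one]; gcongr; exact hu.2.le)
    s (right_mem_Icc.2 hs)
  have e : ∀ w : A, exp (s • x) * z - w - z * exp (s • x)
      = exp (s • x) * z - z * exp (s • x) - w := fun w => by abel
  simp only [sub_self, zero_smul, exp_zero, mul_one, one_mul, sub_zero, e] at this
  calc _ ≤ _ := this
    _ = _ := by ring

/-- The symmetric two-term splitting, with an error bound that uses forward evolution only. -/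
theorem norm_strang_sub_exp_le {a b : A} (ha : IsContractive a) (hb : IsContractive b)
    (hab : IsContractive (a + b)) {t : ℝ} (ht : 0 ≤ t) :
    ‖exp ((t / 2) • a) * exp (t • b) * exp ((t / 2) • a) - exp (t • (a + b))‖
      ≤ t ^ 3 * (‖⁅a, ⁅a, b⁆⁆‖ + ‖⁅b, ⁅b, a⁆⁆‖) := by
  set M := ‖⁅a, ⁅a, b⁆⁆‖ + ‖⁅b, ⁅b, a⁆⁆‖ with hM
  set S : ℝ → A := fun s => exp ((s / 2) • a) * exp (s • b) * exp ((s / 2) • a) with hS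
  -- `R` is the defect `S' - (a + b) S`, arranged so that b and a appear only in commutators with
  -- exponentials.
  set R : ℝ → A := fun s => ⁅exp ((s / 2) • a), b⁆ * exp (s • b) * exp ((s / 2) • a)
    + (1 / 2 : ℝ) • (exp ((s / 2) • a) * ⁅exp (s • b), a⁆ * exp ((s / 2) • a)) with hR
  have hE : ∀ s : ℝ, HasDerivAt (fun s : ℝ => exp ((s / 2) • a))
      ((1 / 2 : ℝ) • (a * exp ((s / 2) • a))) s := fun s => by
    have := (hasDerivAt_exp_smul' a (s / 2)).scomp s ((hasDerivAt_id s).div_const 2)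
    simpa using! this
  have hSd : ∀ s : ℝ, HasDerivAt S ((a + b) * S s + R s) s := by
    intro s
    convert! ((hE s).mul (hasDerivAt_exp_smul' b s)).mul (hE s) using 1
    simp only [hS, hR, Ring.lie_def, Pi.mul_apply]
    have hc := exp_smul_mul_self a (s / 2)
    set E := exp ((s / 2) • a)
    set F := exp (s • b)
    have h1 : E * (F * a - a * F) * E = E * F * (a * E) - a * E * F * E := by
      rw [← hc, mul_sub, sub_mul, ← mul_assoc E a F, hc]; noncomm_ring
    rw [h1]
    simp only [sub_mul, add_mul, smul_sub, smul_mul_assoc, mul_smul_comm, mul_assoc]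
    module
  have hRb : ∀ s ∈ Ico (0 : ℝ) t, ‖R s‖ ≤ t ^ 2 * M := by
    intro s hs
    have hs2 : 0 ≤ s / 2 := by linarith [hs.1]
    have hEn := ha _ hs2
    have hFn := hb _ hs.1
    have o1 := norm_lie_exp_sub_le ha b hs2
    have o2 := norm_lie_exp_sub_le hb a hs.1
    have o3 := norm_lie_exp_le ha ⁅b, a⁆ hs2
    set E := exp ((s / 2) • a)
    set F := exp (s • b)
    set O1 := ⁅E, b⁆ - (s / 2) • (⁅a, b⁆ * E) with hO1
    set O2 := ⁅F, a⁆ - s • (⁅b, a⁆ * F) with hO2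
    set O3 := ⁅E, ⁅b, a⁆⁆ with hO3
    have hba : ⁅b, a⁆ = -⁅a, b⁆ := by simp [Ring.lie_def]
    -- The first-order parts are `(s/2) ⁅a, b⁆ E F E` and `(s/2) E ⁅b, a⁆ F E`. Moving `⁅b, a⁆` to
    -- the left of `E` makes them cancel, at the cost of the term with `O3`.
    have key : R s = O1 * F * E + (1 / 2 : ℝ) • (E * O2 * E) + (s / 2) • (O3 * F * E) := by
      have e1 : ⁅E, b⁆ = O1 + (s / 2) • (⁅a, b⁆ * E) := by rw [hO1]; abel
      have e2 : ⁅F, a⁆ = O2 + s • (⁅b, a⁆ * F) := by rw [hO2]; abel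
      have e3 : E * ⁅b, a⁆ = O3 + ⁅b, a⁆ * E := by rw [hO3, Ring.lie_def E]; abel
      have e4 : E * (⁅b, a⁆ * F) * E = O3 * F * E + ⁅b, a⁆ * E * F * E := by
        rw [← mul_assoc, e3, add_mul, add_mul]
      change ⁅E, b⁆ * F * E + (1 / 2 : ℝ) • (E * ⁅F, a⁆ * E) = _
      rw [e1, e2, mul_add, add_mul, add_mul, add_mul, mul_smul_comm, smul_mul_assoc,
        smul_mul_assoc, smul_mul_assoc, e4, hba]
      simp only [neg_mul]
      module
    have hEFn : ∀ y : A, ‖y * F * E‖ ≤ ‖y‖ := fun y => by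
      calc ‖y * F * E‖ ≤ ‖y‖ * ‖F‖ * ‖E‖ := norm_mul₃_le
        _ ≤ ‖y‖ * 1 * 1 := by gcongr
        _ = ‖y‖ := by ring
    have n1 := (hEFn O1).trans o1
    have n2 := (norm_mul_mul_le_of_contractive (y := O2) hEn hEn).trans o2
    have n3 := (hEFn O3).trans o3
    have hn : ‖⁅a, -⁅a, b⁆⁆‖ = ‖⁅a, ⁅a, b⁆⁆‖ := by
      rw [← norm_neg]; congr 1; simp only [Ring.lie_def]; noncomm_ring
    rw [hba, hn] at n3
    rw [key]
    refine (norm_add₃_le).trans ?_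
    rw [norm_smul, norm_smul, Real.norm_of_nonneg hs2, Real.norm_of_nonneg (by norm_num)]
    have hst : s ^ 2 ≤ t ^ 2 := by gcongr; exacts [hs.1, hs.2.le]
    have p1 : 0 ≤ ‖⁅a, ⁅a, b⁆⁆‖ := norm_nonneg _
    have p2 : 0 ≤ ‖⁅b, ⁅b, a⁆⁆‖ := norm_nonneg _
    have n3' : s / 2 * ‖O3 * F * E‖ ≤ s / 2 * (s / 2 * ‖⁅a, ⁅a, b⁆⁆‖) := by gcongr
    have : s ^ 2 * M ≤ t ^ 2 * M := by gcongr
    rw [hM] at this ⊢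
    nlinarith [mul_nonneg (sq_nonneg s) p1, mul_nonneg (sq_nonneg s) p2]
  -- This path joins `exp (t • (a + b))` to `S t`; differentiation leaves only the defect,
  -- propagated forward.
  have hder : ∀ s : ℝ, HasDerivAt (fun s : ℝ => exp ((t - s) • (a + b)) * S s)
      (exp ((t - s) • (a + b)) * R s) s := by
    intro s
    have h2 : HasDerivAt (fun u : ℝ => exp ((t - u) • (a + b)))
        (-(exp ((t - s) • (a + b)) * (a + b))) s := by
      have := (hasDerivAt_exp_smul (a + b) (t - s)).scomp s ((hasDerivAt_id s).const_sub t)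
      simpa using! this
    convert! h2.mul (hSd s) using 1
    noncomm_ring
  have := norm_image_sub_le_of_norm_deriv_le_segment' (a := 0) (b := t) (C := t ^ 2 * M)
    (fun u _ => (hder u).hasDerivWithinAt)
    (fun u hu => by
      refine (norm_mul_le _ _).trans ?_
      calc _ ≤ 1 * (t ^ 2 * M) := by
            gcongr
            · exact hab _ (by linarith [hu.2])
            · exact hRb u hu
        _ = _ := one_mul _)
    t (right_mem_Icc.2 ht)
  simp only [hS, sub_self, zero_smul, exp_zero, one_mul, sub_zero, zero_div, mul_one] at this
  calc _ ≤ _ := this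
    _ = _ := by ring

/-- The second-order product formula in a Banach algebra. -/
noncomputable def strangProduct {m : ℕ} (x : Fin m → A) (t : ℝ) : A :=
  (List.ofFn fun j => exp ((t / 2) • x j)).prod *
    (List.ofFn fun j => exp ((t / 2) • x j)).reverse.prod

omit [CompleteSpace A] in
theorem strangProduct_succ {m : ℕ} (x : Fin (m + 1) → A) (t : ℝ) :
    strangProduct x t = exp ((t / 2) • x 0) * strangProduct (fun j => x j.succ) t
      * exp ((t / 2) • x 0) := by
  simp [strangProduct, List.ofFn_succ, mul_assoc]

theorem Ring.lie_finset_sum {R ι : Type*} [NonUnitalNonAssocRing R] (a : R) (s : Finset ι)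
    (f : ι → R) : ⁅a, ∑ i ∈ s, f i⁆ = ∑ i ∈ s, ⁅a, f i⁆ := by
  simp only [Ring.lie_def, Finset.mul_sum, Finset.sum_mul, Finset.sum_sub_distrib]

theorem Ring.finset_sum_lie {R ι : Type*} [NonUnitalNonAssocRing R] (a : R) (s : Finset ι)
    (f : ι → R) : ⁅∑ i ∈ s, f i, a⁆ = ∑ i ∈ s, ⁅f i, a⁆ := by
  simp only [Ring.lie_def, Finset.mul_sum, Finset.sum_mul, Finset.sum_sub_distrib]

/-- The sum of the norms of the grade-3 right-nested commutators. -/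
def nestedCommutatorSum {m : ℕ} (x : Fin m → A) : ℝ :=
  ∑ i, ∑ j, ∑ k, ‖⁅x i, ⁅x j, x k⁆⁆‖

omit [NormedAlgebra ℝ A] [CompleteSpace A] in
-- By the triangle inequality the three terms are supported on index triples of shapes `(0, 0, +)`,
-- `(+, +, 0)` and `(+, +, +)`, which are disjoint.
theorem nestedCommutatorSum_succ_ge {m : ℕ} (x : Fin (m + 1) → A) :
    ‖⁅x 0, ⁅x 0, ∑ j : Fin m, x j.succ⁆⁆‖
      + ‖⁅∑ j : Fin m, x j.succ, ⁅∑ j : Fin m, x j.succ, x 0⁆⁆‖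
      + nestedCommutatorSum (fun j : Fin m => x j.succ) ≤ nestedCommutatorSum x := by
  have h1 : ‖⁅x 0, ⁅x 0, ∑ j : Fin m, x j.succ⁆⁆‖ ≤ ∑ k : Fin m, ‖⁅x 0, ⁅x 0, x k.succ⁆⁆‖ := by
    simp only [Ring.lie_finset_sum]
    exact norm_sum_le _ _
  have h2 : ‖⁅∑ j : Fin m, x j.succ, ⁅∑ j : Fin m, x j.succ, x 0⁆⁆‖
      ≤ ∑ i : Fin m, ∑ j : Fin m, ‖⁅x i.succ, ⁅x j.succ, x 0⁆⁆‖ := by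
    simp only [Ring.lie_finset_sum, Ring.finset_sum_lie]
    refine (norm_sum_le _ _).trans ?_
    rw [Finset.sum_comm]
    exact Finset.sum_le_sum fun i _ => norm_sum_le _ _
  have h3 : ∀ f : Fin (m + 1) → Fin (m + 1) → Fin (m + 1) → ℝ, (∀ i j k, 0 ≤ f i j k) →
      (∑ k : Fin m, f 0 0 k.succ) + (∑ i : Fin m, ∑ j : Fin m, f i.succ j.succ 0)
        + (∑ i : Fin m, ∑ j : Fin m, ∑ k : Fin m, f i.succ j.succ k.succ)
        ≤ ∑ i, ∑ j, ∑ k, f i j k := by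
    intro f hf
    simp only [Fin.sum_univ_succ (n := m), Finset.sum_add_distrib]
    have n0 := hf 0 0 0
    have n1 : 0 ≤ ∑ j : Fin m, f 0 j.succ 0 := Finset.sum_nonneg fun _ _ => hf _ _ _
    have n2 : 0 ≤ ∑ j : Fin m, ∑ k : Fin m, f 0 j.succ k.succ :=
      Finset.sum_nonneg fun _ _ => Finset.sum_nonneg fun _ _ => hf _ _ _
    have n3 : 0 ≤ ∑ i : Fin m, f i.succ 0 0 := Finset.sum_nonneg fun _ _ => hf _ _ _
    have n4 : 0 ≤ ∑ i : Fin m, ∑ k : Fin m, f i.succ 0 k.succ :=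
      Finset.sum_nonneg fun _ _ => Finset.sum_nonneg fun _ _ => hf _ _ _
    linarith
  have := h3 (fun i j k => ‖⁅x i, ⁅x j, x k⁆⁆‖) fun _ _ _ => norm_nonneg _
  unfold nestedCommutatorSum
  linarith

/-- Induction peels off the outermost pair of factors: the inner error is sandwiched between
contractions, and the two-term bound is applied to `x 0` against the sum of the rest. -/
theorem norm_strangProduct_sub_exp_le (h1 : ‖(1 : A)‖ ≤ 1) {m : ℕ} (x : Fin m → A)
    (hx : ∀ j, LogNormNonpos (x j)) {t : ℝ} (ht : 0 ≤ t) :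
    ‖strangProduct x t - exp (t • ∑ j, x j)‖ ≤ t ^ 3 * nestedCommutatorSum x := by
  induction m with
  | zero => simp [strangProduct, nestedCommutatorSum]
  | succ m ih =>
    have hsum : LogNormNonpos (∑ j : Fin m, x j.succ) :=
      LogNormNonpos.sum h1 _ fun j _ => hx _
    have hI := ih (fun j => x j.succ) fun j => hx _
    have hS := norm_strang_sub_exp_le (a := x 0) (b := ∑ j : Fin m, x j.succ)
      (fun s hs => (hx 0).norm_exp_le h1 hs) (fun s hs => hsum.norm_exp_le h1 hs)
      (fun s hs => ((hx 0).add hsum).norm_exp_le h1 hs) ht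
    have hE := (hx 0).norm_exp_le h1 (t := t / 2) (by linarith)
    rw [strangProduct_succ, Fin.sum_univ_succ]
    set E := exp ((t / 2) • x 0)
    set B := ∑ j : Fin m, x j.succ
    have e : E * strangProduct (fun j => x j.succ) t * E - exp (t • (x 0 + B))
        = E * (strangProduct (fun j => x j.succ) t - exp (t • B)) * E
          + (E * exp (t • B) * E - exp (t • (x 0 + B))) := by noncomm_ring
    rw [e]
    refine (norm_add_le _ _).trans ?_
    have hI' := (norm_mul_mul_le_of_contractive
      (y := strangProduct (fun j => x j.succ) t - exp (t • B)) hE hE).trans hI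
    have hC := mul_le_mul_of_nonneg_left (nestedCommutatorSum_succ_ge x)
      (pow_nonneg ht 3)
    simp only [mul_add] at hC hS
    linarith

omit [NormedAlgebra ℝ A] [CompleteSpace A] in
-- Telescoping: contractivity keeps each single-step error from growing.
theorem norm_pow_sub_pow_le (h1 : ‖(1 : A)‖ ≤ 1) {x y : A} (hx : ‖x‖ ≤ 1) (hy : ‖y‖ ≤ 1)
    (n : ℕ) : ‖x ^ n - y ^ n‖ ≤ n * ‖x - y‖ := by
  induction n with
  | zero => simp
  | succ n ih =>
    have e : x ^ (n + 1) - y ^ (n + 1) = x ^ n * (x - y) + (x ^ n - y ^ n) * y := by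
      rw [pow_succ, pow_succ]; noncomm_ring
    rw [e]
    have hxn : ‖x ^ n‖ ≤ 1 :=
      (norm_pow_le_pow_of_norm_one_le h1 x n).trans (pow_le_one₀ (norm_nonneg _) hx)
    calc _ ≤ ‖x ^ n‖ * ‖x - y‖ + ‖x ^ n - y ^ n‖ * ‖y‖ :=
          (norm_add_le _ _).trans (add_le_add (norm_mul_le _ _) (norm_mul_le _ _))
      _ ≤ 1 * ‖x - y‖ + n * ‖x - y‖ * 1 := by gcongr
      _ = _ := by push_cast; ring

theorem norm_strangProduct_le_one (h1 : ‖(1 : A)‖ ≤ 1) {m : ℕ} (x : Fin m → A)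
    (hx : ∀ j, LogNormNonpos (x j)) {t : ℝ} (ht : 0 ≤ t) : ‖strangProduct x t‖ ≤ 1 := by
  induction m with
  | zero => simpa [strangProduct] using h1
  | succ m ih =>
    have hE := (hx 0).norm_exp_le h1 (t := t / 2) (by linarith)
    rw [strangProduct_succ]
    exact (norm_mul_mul_le_of_contractive hE hE).trans (ih _ fun j => hx _)

theorem norm_strangProduct_pow_sub_exp_le (h1 : ‖(1 : A)‖ ≤ 1) {m : ℕ} (x : Fin m → A)
    (hx : ∀ j, LogNormNonpos (x j)) {t : ℝ} (ht : 0 ≤ t) {r : ℕ} (hr : 1 ≤ r) :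
    ‖strangProduct x (t / r) ^ r - exp (t • ∑ j, x j)‖
      ≤ t ^ 3 * nestedCommutatorSum x / (r : ℝ) ^ 2 := by
  have hr' : (0 : ℝ) < r := by exact_mod_cast hr
  have htr : 0 ≤ t / r := by positivity
  have e : exp (t • ∑ j, x j) = exp ((t / r) • ∑ j, x j) ^ r := by
    rw [← exp_nat_mul_smul]; congr 2; field_simp
  rw [e]
  refine (norm_pow_sub_pow_le h1 (norm_strangProduct_le_one h1 x hx htr)
    ((LogNormNonpos.sum h1 _ fun j _ => hx j).norm_exp_le h1 htr) r).trans ?_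
  calc _ ≤ r * ((t / r) ^ 3 * nestedCommutatorSum x) := by
        gcongr
        exact norm_strangProduct_sub_exp_le h1 x hx htr
    _ = _ := by field_simp

end BanachAlgebra

/-! ### Trace norm duality and Kraus maps -/

section TraceNorm

open scoped Matrix.Norms.L2Operator
open Matrix ComplexOrder

variable {n : Type} [Fintype n] [DecidableEq n]

theorem traceNorm_nonneg (X : Matrix n n ℂ) : 0 ≤ traceNorm X :=
  Finset.sum_nonneg fun _ _ => Real.sqrt_nonneg _

theorem norm_toEuclideanCLM_eigenvectorBasis (X : Matrix n n ℂ) (i : n) :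
    ‖toEuclideanCLM (n := n) (𝕜 := ℂ) X
        ((isHermitian_conjTranspose_mul_self X).eigenvectorBasis i)‖
      = √((isHermitian_conjTranspose_mul_self X).eigenvalues i) := by
  set hA := isHermitian_conjTranspose_mul_self X
  set v := hA.eigenvectorBasis i
  have hv : toEuclideanCLM (n := n) (𝕜 := ℂ) (Xᴴ * X) v = (hA.eigenvalues i : ℂ) • v := by
    have := hA.mulVec_eigenvectorBasis i
    apply (WithLp.linearEquiv 2 ℂ (n → ℂ)).injective
    simpa using this
  have h2 : inner ℂ v (toEuclideanCLM (n := n) (𝕜 := ℂ) (Xᴴ * X) v)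
      = ((‖toEuclideanCLM (n := n) (𝕜 := ℂ) X v‖ : ℂ)) ^ 2 := by
    rw [← star_eq_conjTranspose, map_mul, map_star, mul_apply_eq_comp,
      ContinuousLinearMap.star_eq_adjoint, ContinuousLinearMap.adjoint_inner_right,
      inner_self_eq_norm_sq_to_K]
    rfl
  rw [hv, inner_smul_right, inner_self_eq_norm_sq_to_K, hA.eigenvectorBasis.norm_eq_one i] at h2
  have h3 : hA.eigenvalues i = ‖toEuclideanCLM (n := n) (𝕜 := ℂ) X v‖ ^ 2 := by
    have : (hA.eigenvalues i : ℂ) = ((‖toEuclideanCLM (n := n) (𝕜 := ℂ) X v‖ ^ 2 : ℝ) : ℂ) := by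
      simpa using h2
    exact_mod_cast this
  rw [h3, Real.sqrt_sq (norm_nonneg _)]

/-- In an eigenbasis of `Xᴴ * X` the vectors `X vᵢ` have the singular values as norms, so the trace
is bounded term by term. With `exists_trace_mul_eq_traceNorm` this makes the trace norm dual to the
operator norm. -/
theorem norm_trace_mul_le (B X : Matrix n n ℂ) : ‖(B * X).trace‖ ≤ ‖B‖ * traceNorm X := by
  set hA := isHermitian_conjTranspose_mul_self X with hhA
  have htr : (B * X).trace = ∑ i, inner ℂ (hA.eigenvectorBasis i)
      (toEuclideanCLM (n := n) (𝕜 := ℂ) (B * X) (hA.eigenvectorBasis i)) := by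
    have h := LinearMap.trace_eq_sum_inner
      (toEuclideanCLM (n := n) (𝕜 := ℂ) (B * X) : EuclideanSpace ℂ n →ₗ[ℂ] EuclideanSpace ℂ n)
      hA.eigenvectorBasis
    rw [← ContinuousLinearMap.coe_coe, ← h, coe_toEuclideanCLM_eq_toEuclideanLin,
      toEuclideanLin_eq_toLin_orthonormal, Matrix.trace_toLin_eq]
  rw [htr, traceNorm, Finset.mul_sum]
  refine (norm_sum_le _ _).trans (Finset.sum_le_sum fun i _ => ?_)
  refine (norm_inner_le_norm _ _).trans ?_
  rw [hA.eigenvectorBasis.norm_eq_one i, one_mul, map_mul, mul_apply_eq_comp,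
    ← norm_toEuclideanCLM_eigenvectorBasis]
  exact (toEuclideanCLM (n := n) (𝕜 := ℂ) B).le_opNorm _

theorem exists_trace_mul_eq_traceNorm (X : Matrix n n ℂ) :
    ∃ B : Matrix n n ℂ, ‖B‖ ≤ 1 ∧ (B * X).trace = traceNorm X := by
  set hA := isHermitian_conjTranspose_mul_self X with hhA
  have hpos : ∀ i, 0 ≤ hA.eigenvalues i := (posSemidef_conjTranspose_mul_self X).eigenvalues_nonneg
  set U := hA.eigenvectorUnitary with hU
  set D : Matrix n n ℂ := diagonal (RCLike.ofReal ∘ hA.eigenvalues) with hD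
  set G : Matrix n n ℂ := diagonal fun i => (((√(hA.eigenvalues i))⁻¹ : ℝ) : ℂ) with hG
  have hspec : Xᴴ * X = (U : Matrix n n ℂ) * D * star (U : Matrix n n ℂ) := by
    conv_lhs => rw [hA.spectral_theorem, Unitary.conjStarAlgAut_apply]
  have hUU : star (U : Matrix n n ℂ) * (U : Matrix n n ℂ) = 1 := Unitary.coe_star_mul_self U
  have hUU' : ∀ Z : Matrix n n ℂ, star (U : Matrix n n ℂ) * ((U : Matrix n n ℂ) * Z) = Z :=
    fun Z => by rw [← mul_assoc, hUU, one_mul]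
  have hGs : Gᴴ = G := by
    rw [hG, diagonal_conjTranspose]; congr 1; ext i; simp
  set M := (U : Matrix n n ℂ) * G * star (U : Matrix n n ℂ) with hM
  have hMs : Mᴴ = M := by
    rw [hM]; simp only [star_eq_conjTranspose, conjTranspose_mul, hGs, conjTranspose_conjTranspose,
      mul_assoc]
  -- `M` is the pseudo-inverse square root of `Xᴴ * X`; the convention `0⁻¹ = 0` covers the kernel.
  -- By the C*-identity the squared norm of `M * Xᴴ` is that of the projection `M Xᴴ X M`.
  refine ⟨M * Xᴴ, ?_, ?_⟩
  · have h := l2_opNorm_conjTranspose_mul_self (M * Xᴴ)ᴴ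
    have e : (M * Xᴴ)ᴴᴴ * (M * Xᴴ)ᴴ
        = (U : Matrix n n ℂ) * (G * D * G) * star (U : Matrix n n ℂ) := by
      rw [conjTranspose_conjTranspose, conjTranspose_mul, conjTranspose_conjTranspose, hMs]
      rw [show M * Xᴴ * (X * M) = M * (Xᴴ * X) * M by simp only [mul_assoc], hspec, hM]
      simp only [mul_assoc, hUU']
    rw [e, ← Unitary.coe_star, CStarRing.norm_mul_coe_unitary, CStarRing.norm_coe_unitary_mul,
      l2_opNorm_conjTranspose] at h
    have hd : ‖G * D * G‖ ≤ 1 := by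
      rw [hG, hD, diagonal_mul_diagonal, diagonal_mul_diagonal, l2_opNorm_diagonal,
        pi_norm_le_iff_of_nonneg zero_le_one]
      intro i
      have hc : (((√(hA.eigenvalues i))⁻¹ : ℝ) : ℂ) * (RCLike.ofReal ∘ hA.eigenvalues) i
          * (((√(hA.eigenvalues i))⁻¹ : ℝ) : ℂ)
          = (((√(hA.eigenvalues i))⁻¹ * hA.eigenvalues i * (√(hA.eigenvalues i))⁻¹ : ℝ) : ℂ) := by
        push_cast; rfl
      rw [hc, Complex.norm_real]
      rcases (hpos i).eq_or_lt with h0 | h0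
      · rw [← h0]; simp
      · have h1 : √(hA.eigenvalues i) ≠ 0 := (Real.sqrt_pos.2 h0).ne'
        have h2 : (√(hA.eigenvalues i))⁻¹ * hA.eigenvalues i * (√(hA.eigenvalues i))⁻¹ = 1 := by
          nth_rewrite 2 [← Real.mul_self_sqrt h0.le]
          field_simp
        rw [h2]; simp
    nlinarith [norm_nonneg (M * Xᴴ)]
  · rw [mul_assoc, hspec, hM]
    have e : (U : Matrix n n ℂ) * G * star (U : Matrix n n ℂ)
        * ((U : Matrix n n ℂ) * D * star (U : Matrix n n ℂ))
        = (U : Matrix n n ℂ) * (G * D * star (U : Matrix n n ℂ)) := by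
      simp only [mul_assoc, hUU']
    rw [e, trace_mul_comm, mul_assoc, hUU, mul_one, hG, hD, diagonal_mul_diagonal, trace_diagonal,
      traceNorm]
    push_cast
    refine Finset.sum_congr rfl fun i _ => ?_
    have : (√(hA.eigenvalues i))⁻¹ * hA.eigenvalues i = √(hA.eigenvalues i) := by
      rw [inv_mul_eq_div, Real.div_sqrt]
    calc _ = (((√(hA.eigenvalues i))⁻¹ * hA.eigenvalues i : ℝ) : ℂ) := by push_cast; rfl
      _ = _ := by rw [this]

theorem traceNorm_le_of_forall {X : Matrix n n ℂ} {c : ℝ}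
    (h : ∀ B : Matrix n n ℂ, ‖B‖ ≤ 1 → ‖(B * X).trace‖ ≤ c) : traceNorm X ≤ c := by
  obtain ⟨B, hB, hBX⟩ := exists_trace_mul_eq_traceNorm X
  have := h B hB
  rwa [hBX, Complex.norm_real, Real.norm_of_nonneg (traceNorm_nonneg X)] at this

theorem norm_trace_mul_le_traceNorm {B : Matrix n n ℂ} (hB : ‖B‖ ≤ 1) (X : Matrix n n ℂ) :
    ‖(B * X).trace‖ ≤ traceNorm X :=
  (norm_trace_mul_le B X).trans (mul_le_of_le_one_left (traceNorm_nonneg X) hB)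

theorem traceNorm_add_le (X Y : Matrix n n ℂ) : traceNorm (X + Y) ≤ traceNorm X + traceNorm Y :=
  traceNorm_le_of_forall fun B hB => by
    rw [mul_add, trace_add]
    exact (norm_add_le _ _).trans (add_le_add (norm_trace_mul_le_traceNorm hB X)
      (norm_trace_mul_le_traceNorm hB Y))

theorem traceNorm_smul (c : ℂ) (X : Matrix n n ℂ) : traceNorm (c • X) = ‖c‖ * traceNorm X := by
  have hle : ∀ (c : ℂ) (X : Matrix n n ℂ), traceNorm (c • X) ≤ ‖c‖ * traceNorm X := fun c X =>
    traceNorm_le_of_forall fun B hB => by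
      rw [mul_smul_comm, trace_smul, norm_smul]
      gcongr
      exact norm_trace_mul_le_traceNorm hB X
  refine le_antisymm (hle c X) ?_
  by_cases hc : c = 0
  · simpa [hc] using traceNorm_nonneg _
  · have := hle c⁻¹ (c • X)
    rwa [inv_smul_smul₀ hc, norm_inv, inv_mul_eq_div, le_div_iff₀' (norm_pos_iff.2 hc)] at this

theorem traceNorm_eq_zero_iff (X : Matrix n n ℂ) : traceNorm X = 0 ↔ X = 0 := by
  constructor
  · intro h
    have := norm_trace_mul_le Xᴴ X
    rw [h, mul_zero, norm_le_zero_iff] at this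
    exact trace_conjTranspose_mul_self_eq_zero_iff.1 this
  · rintro rfl
    simpa using traceNorm_smul (0 : ℂ) (0 : Matrix n n ℂ)

/-- Block-diagonal repetition of a matrix, as a homomorphism of star algebras. -/
noncomputable def blockDiagonalConst (n o : Type) [Fintype n] [DecidableEq n] [Fintype o]
    [DecidableEq o] : Matrix n n ℂ →⋆ₐ[ℂ] Matrix (n × o) (n × o) ℂ where
  toFun B := blockDiagonal fun _ => B
  map_one' := blockDiagonal_one
  map_mul' A B := by rw [← blockDiagonal_mul]
  map_zero' := blockDiagonal_zero
  map_add' A B := by rw [← blockDiagonal_add]; rfl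
  commutes' r := by
    ext ⟨i, a⟩ ⟨j, b⟩
    simp only [blockDiagonal_apply, algebraMap_matrix_apply, Prod.mk.injEq]
    split_ifs <;> simp_all
  map_star' B := by
    rw [star_eq_conjTranspose, star_eq_conjTranspose, blockDiagonal_conjTranspose]

/-- Homomorphisms of C*-algebras are contractive. -/
theorem norm_blockDiagonal_const_le {o : Type} [Fintype o] [DecidableEq o] (B : Matrix n n ℂ) :
    ‖blockDiagonal fun _ : o => B‖ ≤ ‖B‖ :=
  NonUnitalStarAlgHom.norm_apply_le (blockDiagonalConst n o) B

/-- Stacking the `K a` into one column `V` turns the sum into `Vᴴ (B ⊗ 1) V`, and `‖V‖² = ‖Vᴴ V‖`.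
-/
theorem norm_sum_conjTranspose_mul_mul_le {o : Type} [Fintype o] [DecidableEq o]
    (K : o → Matrix n n ℂ) (B : Matrix n n ℂ) :
    ‖∑ a, (K a)ᴴ * B * K a‖ ≤ ‖B‖ * ‖∑ a, (K a)ᴴ * K a‖ := by
  set V : Matrix (n × o) n ℂ := Matrix.of fun p j => K p.2 p.1 j with hV
  have h : ∀ B : Matrix n n ℂ, ∑ a, (K a)ᴴ * B * K a
      = Vᴴ * (blockDiagonal fun _ : o => B) * V := by
    intro B
    ext i j
    simp only [Matrix.sum_apply, mul_apply, blockDiagonal_apply, conjTranspose_apply, hV, of_apply,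
      Fintype.sum_prod_type, mul_ite, mul_zero, Finset.sum_ite_eq', Finset.mem_univ, if_true]
    rw [Finset.sum_comm]
  have h1 : ∑ a, (K a)ᴴ * K a = Vᴴ * V := by
    have e := h 1
    have e1 : (blockDiagonal fun _ : o => (1 : Matrix n n ℂ)) = 1 := blockDiagonal_one
    simpa [e1] using e
  rw [h1, h B, l2_opNorm_conjTranspose_mul_self]
  calc _ ≤ ‖Vᴴ * (blockDiagonal fun _ : o => B)‖ * ‖V‖ := l2_opNorm_mul _ _
    _ ≤ ‖Vᴴ‖ * ‖blockDiagonal fun _ : o => B‖ * ‖V‖ := by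
        gcongr; exact l2_opNorm_mul _ _
    _ ≤ ‖V‖ * ‖B‖ * ‖V‖ := by
        rw [l2_opNorm_conjTranspose]
        gcongr
        exact norm_blockDiagonal_const_le B
    _ = _ := by ring

/-- By duality and cyclicity of the trace, the Kraus map can be moved onto the test matrix `B`. -/
theorem traceNorm_sum_mul_mul_conjTranspose_le {o : Type} [Fintype o] [DecidableEq o]
    (K : o → Matrix n n ℂ) (X : Matrix n n ℂ) :
    traceNorm (∑ a, K a * X * (K a)ᴴ) ≤ ‖∑ a, (K a)ᴴ * K a‖ * traceNorm X :=
  traceNorm_le_of_forall fun B hB => by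
    have e : (B * ∑ a, K a * X * (K a)ᴴ).trace = ((∑ a, (K a)ᴴ * B * K a) * X).trace := by
      rw [Finset.mul_sum, Finset.sum_mul, trace_sum, trace_sum]
      refine Finset.sum_congr rfl fun a _ => ?_
      rw [← mul_assoc, trace_mul_comm]
      simp only [mul_assoc]
    rw [e]
    refine (norm_trace_mul_le _ _).trans ?_
    gcongr
    · exact traceNorm_nonneg X
    · exact (norm_sum_conjTranspose_mul_mul_le K B).trans
        (mul_le_of_le_one_left (norm_nonneg _) hB)

theorem traceNorm_mul_mul_le (A X B : Matrix n n ℂ) :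
    traceNorm (A * X * B) ≤ ‖A‖ * ‖B‖ * traceNorm X :=
  traceNorm_le_of_forall fun C hC => by
    have e : (C * (A * X * B)).trace = (B * C * A * X).trace := by
      rw [← mul_assoc, trace_mul_comm]
      simp only [mul_assoc]
    rw [e]
    refine (norm_trace_mul_le _ _).trans ?_
    gcongr
    · exact traceNorm_nonneg X
    · calc ‖B * C * A‖ ≤ ‖B‖ * ‖C‖ * ‖A‖ := norm_mul₃_le
        _ ≤ ‖B‖ * 1 * ‖A‖ := by gcongr
        _ = _ := by ring

theorem norm_matrix_one_le : ‖(1 : Matrix n n ℂ)‖ ≤ 1 := by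
  rw [← diagonal_one, l2_opNorm_diagonal, pi_norm_le_iff_of_nonneg zero_le_one]
  simp

end TraceNorm

/-! ### The trace-norm Banach space of matrices -/

noncomputable section

/-- Matrices, to be equipped with the trace norm. -/
def TraceClass (m : Type) : Type := Matrix m m ℂ

namespace TraceClass

variable {m : Type} [Fintype m] [DecidableEq m]

instance : AddCommGroup (TraceClass m) := inferInstanceAs (AddCommGroup (Matrix m m ℂ))

instance : Module ℂ (TraceClass m) := inferInstanceAs (Module ℂ (Matrix m m ℂ))

instance : FiniteDimensional ℂ (TraceClass m) :=
  inferInstanceAs (FiniteDimensional ℂ (Matrix m m ℂ))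

instance : Norm (TraceClass m) := ⟨fun X => traceNorm (n := m) X⟩

theorem normedSpaceCore : NormedSpace.Core ℂ (TraceClass m) where
  norm_nonneg X := traceNorm_nonneg (n := m) X
  norm_smul c X := traceNorm_smul (n := m) c X
  norm_triangle X Y := traceNorm_add_le (n := m) X Y
  norm_eq_zero_iff X := traceNorm_eq_zero_iff (n := m) X

instance : NormedAddCommGroup (TraceClass m) := NormedAddCommGroup.ofCore normedSpaceCore

instance : NormedSpace ℂ (TraceClass m) := NormedSpace.ofCore normedSpaceCore

instance : CompleteSpace (TraceClass m) := FiniteDimensional.complete ℂ _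

end TraceClass

/-! ### The diamond norm as an operator norm; Lindbladians as dissipative elements -/

section Channels

open Matrix
open scoped Kronecker

variable {m n : Type} [Fintype m] [DecidableEq m] [Fintype n] [DecidableEq n]

/-- Superoperators as continuous linear maps for the trace norm. -/
def traceCLM : Superop m ≃ₐ[ℂ] (TraceClass m →L[ℂ] TraceClass m) :=
  Module.End.toContinuousLinearMap (𝕜 := ℂ) (TraceClass m)

theorem norm_traceCLM_le {Ψ : Superop m} {c : ℝ} (hc : 0 ≤ c)
    (h : ∀ X, traceNorm (Ψ X) ≤ c * traceNorm X) : ‖traceCLM Ψ‖ ≤ c :=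
  ContinuousLinearMap.opNorm_le_bound _ hc h

/-- Ampliation by an ancilla, as a homomorphism of algebras. -/
def ampliationHom : Superop n →ₐ[ℂ] Superop (n × n) :=
  AlgHom.ofLinearMap
    { toFun := fun Φ =>
        { toFun := ampliation Φ
          map_add' := fun X Y => by
            ext a b
            have := congrFun₂ (map_add Φ (Matrix.of fun i j => X (i, a.2) (j, b.2))
              (Matrix.of fun i j => Y (i, a.2) (j, b.2))) a.1 b.1
            exact this
          map_smul' := fun c X => by
            ext a b
            have := congrFun₂ (map_smul Φ c (Matrix.of fun i j => X (i, a.2) (j, b.2))) a.1 b.1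
            exact this }
      map_add' := fun Φ Ψ => rfl
      map_smul' := fun c Φ => rfl }
    rfl (fun Φ Ψ => rfl)

theorem ampliationHom_apply (Φ : Superop n) (X : Matrix (n × n) (n × n) ℂ) :
    ampliationHom Φ X = ampliation Φ X := rfl

theorem ampliationHom_sandwich (A B : Matrix n n ℂ) :
    ampliationHom (sandwich A B) = sandwich (A ⊗ₖ (1 : Matrix n n ℂ)) (B ⊗ₖ (1 : Matrix n n ℂ)) := by
  ext1 X
  ext a b
  rw [ampliationHom_apply, sandwich_apply]
  simp only [ampliation, sandwich_apply, of_apply, mul_apply, kroneckerMap_apply,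
    Fintype.sum_prod_type, one_apply, mul_ite, mul_one, mul_zero, ite_mul, zero_mul,
    Finset.sum_ite_eq, Finset.sum_ite_eq', Finset.mem_univ, if_true]

theorem ampliationHom_coherentTerm (H : Matrix n n ℂ) :
    ampliationHom (coherentTerm H) = coherentTerm (H ⊗ₖ (1 : Matrix n n ℂ)) := by
  simp only [coherentTerm, map_smul, map_sub, ampliationHom_sandwich, one_kronecker_one]

theorem ampliationHom_dissipator (J : Matrix n n ℂ) :
    ampliationHom (dissipator J) = dissipator (J ⊗ₖ (1 : Matrix n n ℂ)) := by
  simp only [dissipator, crossDissipator, map_smul, map_sub, map_add, ampliationHom_sandwich,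
    one_kronecker_one, conjTranspose_kronecker, conjTranspose_one, ← mul_kronecker_mul, mul_one]

/-- The representation of superoperators whose operator norm is the diamond norm. -/
def diamondHom : Superop n →ₐ[ℂ] (TraceClass (n × n) →L[ℂ] TraceClass (n × n)) :=
  (traceCLM (m := n × n)).toAlgHom.comp ampliationHom

theorem norm_diamondHom (Φ : Superop n) : ‖diamondHom Φ‖ = diamondNorm Φ := by
  rw [← ContinuousLinearMap.sSup_unitClosedBall_eq_norm, diamondNorm]
  congr 1
  ext c
  constructor
  · rintro ⟨X, hX, rfl⟩
    exact ⟨X, mem_closedBall_zero_iff.1 hX, rfl⟩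
  · rintro ⟨X, hX, rfl⟩
    exact ⟨X, mem_closedBall_zero_iff.2 hX, rfl⟩

theorem norm_one_traceClass_le : ‖(1 : TraceClass m →L[ℂ] TraceClass m)‖ ≤ 1 :=
  ContinuousLinearMap.norm_id_le

/-- An algebra homomorphism between finite-dimensional algebras is continuous whatever the norms, so
it commutes with the exponential series. -/
theorem diamondHom_evolution (L : Superop n) (t : ℝ) :
    diamondHom (evolution L t) = NormedSpace.exp (t • diamondHom L) := by
  open scoped Matrix.Norms.L2Operator in
  let e : (Matrix n n ℂ →L[ℂ] Matrix n n ℂ) ≃ₐ[ℂ] Superop n :=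
    (Module.End.toContinuousLinearMap (𝕜 := ℂ) (Matrix n n ℂ)).symm
  open scoped Matrix.Norms.L2Operator in
  let f : (Matrix n n ℂ →L[ℂ] Matrix n n ℂ) →ₐ[ℂ] (TraceClass (n × n) →L[ℂ] TraceClass (n × n)) :=
    diamondHom.comp e.toAlgHom
  open scoped Matrix.Norms.L2Operator in
  have hf : Continuous f := f.toLinearMap.continuous_of_finiteDimensional
  open scoped Matrix.Norms.L2Operator in
  have h := NormedSpace.map_exp_of_mem_ball (𝕂 := ℂ)
    (𝔸 := Matrix n n ℂ →L[ℂ] Matrix n n ℂ) f hf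
    (LinearMap.toContinuousLinearMap ((t : ℂ) • L))
    ((NormedSpace.expSeries_radius_eq_top ℂ (Matrix n n ℂ →L[ℂ] Matrix n n ℂ)).symm ▸ edist_lt_top _ _)
  have h2 : f (LinearMap.toContinuousLinearMap ((t : ℂ) • L)) = t • diamondHom L := by
    change diamondHom ((t : ℂ) • L) = _
    rw [map_smul, Complex.coe_smul]
  rw [← h2]
  exact h

open scoped Matrix.Norms.L2Operator in
theorem norm_traceCLM_sandwich_le (A B : Matrix m m ℂ) :
    ‖traceCLM (sandwich A B)‖ ≤ ‖A‖ * ‖B‖ :=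
  norm_traceCLM_le (by positivity) fun X => by
    rw [sandwich_apply]; exact traceNorm_mul_mul_le A X B

open scoped Matrix.Norms.L2Operator in
theorem norm_traceCLM_sum_sandwich_le {o : Type} [Fintype o] [DecidableEq o]
    (K : o → Matrix m m ℂ) :
    ‖traceCLM (∑ a, sandwich (K a) (K a)ᴴ)‖ ≤ ‖∑ a, (K a)ᴴ * K a‖ :=
  norm_traceCLM_le (norm_nonneg _) fun X => by
    have e : (∑ a, sandwich (K a) (K a)ᴴ) X = ∑ a, K a * X * (K a)ᴴ := by
      simp [LinearMap.sum_apply, sandwich_apply]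
    rw [e]
    exact traceNorm_sum_mul_mul_conjTranspose_le K X

theorem traceCLM_one_add_smul (Ψ : Superop m) (s : ℝ) :
    1 + s • traceCLM Ψ = traceCLM (1 + (s : ℂ) • Ψ) := by
  rw [map_add, map_one, map_smul, Complex.coe_smul]

open scoped Matrix.Norms.L2Operator in
theorem logNormNonpos_traceCLM_coherentTerm {H : Matrix m m ℂ} (hH : H.IsHermitian) :
    LogNormNonpos (traceCLM (coherentTerm H)) := by
  refine logNormNonpos_of_norm_le (c := ‖H * H‖ + ‖H‖ * ‖H‖) fun s _ => ?_
  -- One Euler step is conjugation by `1 - isH` minus `s² H X H`, and `Kᴴ * K = 1 + s² H²`: both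
  -- corrections are quadratic in s.
  set K : Matrix m m ℂ := 1 - ((s : ℂ) * Complex.I) • H with hK
  have hKs : Kᴴ = 1 + ((s : ℂ) * Complex.I) • H := by
    rw [hK, conjTranspose_sub, conjTranspose_one, conjTranspose_smul, hH.eq]
    simp
  have e : 1 + (s : ℂ) • coherentTerm H
      = (∑ _a : Unit, sandwich K Kᴴ) - ((s : ℂ) ^ 2) • sandwich H H := by
    ext1 X
    simp only [Finset.univ_unique, Finset.sum_singleton, LinearMap.add_apply, LinearMap.sub_apply,
      LinearMap.smul_apply, Module.End.one_apply, sandwich_apply, coherentTerm_apply, hKs]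
    simp only [hK, sub_mul, mul_add, one_mul, mul_one, smul_mul_assoc, mul_smul_comm, smul_sub,
      smul_smul, Matrix.mul_assoc]
    have hI : (s : ℂ) * Complex.I * ((s : ℂ) * Complex.I) = -(s : ℂ) ^ 2 := by
      rw [mul_mul_mul_comm, Complex.I_mul_I]; ring
    rw [hI]
    module
  have e2 : ∑ _a : Unit, Kᴴ * K = 1 + ((s : ℂ) ^ 2) • (H * H) := by
    simp only [Finset.univ_unique, Finset.sum_singleton, hKs]
    simp only [hK, mul_sub, add_mul, one_mul, mul_one, smul_mul_assoc, mul_smul_comm]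
    have hI : (s : ℂ) * Complex.I * ((s : ℂ) * Complex.I) = -(s : ℂ) ^ 2 := by
      rw [mul_mul_mul_comm, Complex.I_mul_I]; ring
    rw [smul_add, smul_smul, hI]
    module
  rw [traceCLM_one_add_smul, e, map_sub, map_smul]
  refine (norm_sub_le _ _).trans ?_
  have hs : ‖(s : ℂ) ^ 2‖ = s ^ 2 := by simp
  have h1 := norm_traceCLM_sum_sandwich_le fun _ : Unit => K
  rw [e2] at h1
  have h2 : ‖1 + ((s : ℂ) ^ 2) • (H * H)‖ ≤ 1 + s ^ 2 * ‖H * H‖ := by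
    refine (norm_add_le _ _).trans ?_
    rw [norm_smul, hs]
    gcongr
    exact norm_matrix_one_le
  have h3 := norm_traceCLM_sandwich_le H H
  rw [norm_smul, hs]
  have := mul_le_mul_of_nonneg_left h3 (sq_nonneg s)
  linarith

open scoped Matrix.Norms.L2Operator in
theorem logNormNonpos_traceCLM_dissipator (J : Matrix m m ℂ) :
    LogNormNonpos (traceCLM (dissipator J)) := by
  set P := Jᴴ * J with hP
  have hPs : Pᴴ = P := by simp [hP]
  refine logNormNonpos_of_norm_le (c := ‖P * P‖ + ‖P‖ * ‖P‖) fun s hs0 => ?_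
  -- These Kraus operators reproduce the Euler step up to `(s²/4) P X P`, and `∑ Kᴴ K = 1 + (s²/4)
  -- P²`. The square root is where `s ≥ 0` enters.
  set K : Fin 2 → Matrix m m ℂ := ![1 - ((s : ℂ) / 2) • P, ((√s : ℝ) : ℂ) • J] with hK
  have hroot : ((√s : ℝ) : ℂ) * ((√s : ℝ) : ℂ) = s := by
    rw [← Complex.ofReal_mul, Real.mul_self_sqrt hs0]
  have h0 : (K 0)ᴴ = 1 - ((s : ℂ) / 2) • P := by
    simp [hK, conjTranspose_sub, conjTranspose_smul, hPs]
  have h1 : (K 1)ᴴ = ((√s : ℝ) : ℂ) • Jᴴ := by simp [hK, conjTranspose_smul]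
  have e : 1 + (s : ℂ) • dissipator J
      = (∑ a, sandwich (K a) (K a)ᴴ) - ((s : ℂ) ^ 2 / 4) • sandwich P P := by
    ext1 X
    rw [Fin.sum_univ_two, h0, h1]
    simp only [LinearMap.add_apply, LinearMap.sub_apply, LinearMap.smul_apply,
      Module.End.one_apply, sandwich_apply, dissipator_apply, hK, cons_val_zero, cons_val_one,
      ← hP]
    simp only [sub_mul, mul_sub, one_mul, mul_one, smul_mul_assoc, mul_smul_comm, smul_sub,
      smul_smul, hroot, mul_assoc]
    module
  have e2 : ∑ a, (K a)ᴴ * K a = 1 + ((s : ℂ) ^ 2 / 4) • (P * P) := by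
    rw [Fin.sum_univ_two, h0, h1]
    simp only [hK, cons_val_zero, cons_val_one, mul_sub, sub_mul, one_mul, mul_one,
      smul_mul_assoc, mul_smul_comm, smul_smul, hroot, ← hP]
    module
  rw [traceCLM_one_add_smul, e, map_sub, map_smul]
  refine (norm_sub_le _ _).trans ?_
  have hs : ‖(s : ℂ) ^ 2 / 4‖ = s ^ 2 / 4 := by simp
  have n1 := norm_traceCLM_sum_sandwich_le K
  rw [e2] at n1
  have n2 : ‖1 + ((s : ℂ) ^ 2 / 4) • (P * P)‖ ≤ 1 + s ^ 2 / 4 * ‖P * P‖ := by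
    refine (norm_add_le _ _).trans ?_
    rw [norm_smul, hs]
    gcongr
    exact norm_matrix_one_le
  have n3 := norm_traceCLM_sandwich_le P P
  rw [norm_smul, hs]
  have := mul_le_mul_of_nonneg_left n3 (by positivity : 0 ≤ s ^ 2 / 4)
  have p1 : 0 ≤ s ^ 2 * ‖P * P‖ := by positivity
  have p2 : 0 ≤ s ^ 2 * (‖P‖ * ‖P‖) := by positivity
  linarith

/-- Adding the ancilla only replaces `H` and `J` by `H ⊗ 1` and `J ⊗ 1`, so the trace-norm estimates
on the doubled space apply. -/
theorem IsLindbladian.logNormNonpos_diamondHom {L : Superop n} (hL : IsLindbladian L) :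
    LogNormNonpos (diamondHom L) := by
  obtain ⟨H, p, J, hH, rfl⟩ := hL
  rw [map_add, map_sum]
  refine LogNormNonpos.add ?_ (LogNormNonpos.sum norm_one_traceClass_le _ fun ν _ => ?_)
  · have : (H ⊗ₖ (1 : Matrix n n ℂ)).IsHermitian := by
      rw [IsHermitian, conjTranspose_kronecker, hH.eq, conjTranspose_one]
    have h := logNormNonpos_traceCLM_coherentTerm this
    rwa [← ampliationHom_coherentTerm] at h
  · have h := logNormNonpos_traceCLM_dissipator (J ν ⊗ₖ (1 : Matrix n n ℂ))
    rwa [← ampliationHom_dissipator] at h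

theorem isLindbladian_coherentTerm {H : Matrix n n ℂ} (hH : H.IsHermitian) :
    IsLindbladian (coherentTerm H) :=
  ⟨H, 0, Fin.elim0, hH, by simp⟩

theorem isLindbladian_dissipator (J : Matrix n n ℂ) : IsLindbladian (dissipator J) :=
  ⟨0, 1, fun _ => J, isHermitian_zero, by
    have : coherentTerm (0 : Matrix n n ℂ) = 0 := by ext1 X; simp [coherentTerm_apply]
    simp [this]⟩

theorem diamondHom_productFormula {k : ℕ} (L : Fin k → Superop n) (t : ℝ) :
    diamondHom (productFormula L t) = strangProduct (fun j => diamondHom (L j)) t := by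
  simp only [productFormula, strangProduct, map_mul, map_list_prod, List.map_reverse,
    List.map_ofFn, Function.comp_def, diamondHom_evolution]

theorem map_lie_of_algHom {R S : Type*} [Ring R] [Ring S] [Algebra ℂ R] [Algebra ℂ S]
    (f : R →ₐ[ℂ] S) (x y : R) : f ⁅x, y⁆ = ⁅f x, f y⁆ := by
  simp [Ring.lie_def]

theorem alphaComm3_eq {k : ℕ} (L : Fin k → Superop n) :
    alphaComm3 L = nestedCommutatorSum fun j => diamondHom (L j) := by
  simp only [alphaComm3, nestedCommutatorSum, ← norm_diamondHom, map_lie_of_algHom]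

theorem alphaComm3_nonneg {k : ℕ} (L : Fin k → Superop n) : 0 ≤ alphaComm3 L := by
  rw [alphaComm3_eq]
  exact Finset.sum_nonneg fun _ _ => Finset.sum_nonneg fun _ _ => Finset.sum_nonneg fun _ _ =>
    norm_nonneg _

theorem trotterError_le {k : ℕ} (L : Fin k → Superop n) (hL : ∀ j, IsLindbladian (L j))
    {t : ℝ} (ht : 0 ≤ t) {r : ℕ} (hr : 1 ≤ r) :
    trotterError L t r ≤ t ^ 3 * alphaComm3 L / (r : ℝ) ^ 2 := by
  rw [trotterError, ← norm_diamondHom, map_sub, map_pow, diamondHom_productFormula,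
    diamondHom_evolution, map_sum, alphaComm3_eq]
  exact norm_strangProduct_pow_sub_exp_le norm_one_traceClass_le _
    (fun j => (hL j).logNormNonpos_diamondHom) ht hr

theorem exists_trotter_steps {k : ℕ} (L : Fin k → Superop n) (hL : ∀ j, IsLindbladian (L j))
    {t ε : ℝ} (ht : 0 < t) (hε : 0 < ε) :
    ∃ r₀ : ℕ, 1 ≤ r₀ ∧
      (r₀ : ℝ) ≤ max 1 (2 * (√(alphaComm3 L) * t ^ (3 / 2 : ℝ) / √ε)) ∧
      ∀ r : ℕ, r₀ ≤ r → trotterError L t r ≤ ε := by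
  set α := alphaComm3 L with hα
  have hα0 : 0 ≤ α := alphaComm3_nonneg L
  set y := √α * t ^ (3 / 2 : ℝ) / √ε with hy
  have hy0 : 0 ≤ y := by positivity
  have hy2 : y ^ 2 * ε = t ^ 3 * α := by
    have ht3 : (t ^ (3 / 2 : ℝ)) ^ 2 = t ^ 3 := by
      rw [← Real.rpow_natCast, ← Real.rpow_mul ht.le, ← Real.rpow_natCast]; norm_num
    rw [hy, div_pow, mul_pow, Real.sq_sqrt hα0, Real.sq_sqrt hε.le, ht3]
    field_simp
  -- `y` is the step number at which the bound `t³ α / r²` equals ε. The constant 2 absorbs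
  -- rounding: `⌈y⌉ < y + 1 < 2y` for `y > 1`.
  refine ⟨max 1 ⌈y⌉₊, le_max_left _ _, ?_, fun r hr => ?_⟩
  · rcases le_or_gt y 1 with h | h
    · have : ⌈y⌉₊ ≤ 1 := Nat.ceil_le.2 (by simpa using h)
      rw [max_eq_left this]
      simp
    · have h1 : (1 : ℕ) ≤ ⌈y⌉₊ := Nat.one_le_ceil_iff.2 (by linarith)
      rw [max_eq_right h1]
      refine le_max_of_le_right ?_
      have := Nat.ceil_lt_add_one hy0
      linarith
  · have hr1 : 1 ≤ r := (le_max_left _ _).trans hr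
    have hyr : y ≤ r := (Nat.le_ceil y).trans (by exact_mod_cast (le_max_right _ _).trans hr)
    have hr0 : (0 : ℝ) < r := by exact_mod_cast hr1
    refine (trotterError_le L hL ht.le hr1).trans ?_
    rw [div_le_iff₀ (by positivity), ← hα, ← hy2, mul_comm]
    gcongr

end Channels

end

/-! ### Commutation of kernels with disjoint nontrivial factors -/

noncomputable section

section ProductKernels

variable {ι : Type*} [Fintype ι] [DecidableEq ι] {α : ι → Type*} [∀ i, Fintype (α i)]

/-- A kernel on a product space has the form `M' ⊗ 1` with respect to the factor `j`. -/
def TrivialAt (M : Matrix (∀ i, α i) (∀ i, α i) ℂ) (j : ι) : Prop :=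
  (∀ x y, x j ≠ y j → M x y = 0) ∧
    ∀ x y s, x j = y j → M (Function.update x j s) (Function.update y j s) = M x y

omit [Fintype ι] [∀ i, Fintype (α i)] in
theorem TrivialAt.piecewise_eq {M : Matrix (∀ i, α i) (∀ i, α i) ℂ} (T : Finset ι)
    (hM : ∀ j ∈ T, TrivialAt M j) (z x y : ∀ i, α i) (hxy : ∀ j ∈ T, x j = y j) :
    M (T.piecewise z x) (T.piecewise z y) = M x y := by
  induction T using Finset.induction_on with
  | empty => simp
  | insert j T hj ih =>
    rw [Finset.piecewise_insert, Finset.piecewise_insert,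
      (hM j (Finset.mem_insert_self j T)).2 _ _ _ ?_,
      ih (fun i hi => hM i (Finset.mem_insert_of_mem hi))
        fun i hi => hxy i (Finset.mem_insert_of_mem hi)]
    rw [Finset.piecewise_eq_of_notMem _ _ _ hj, Finset.piecewise_eq_of_notMem _ _ _ hj]
    exact hxy j (Finset.mem_insert_self j T)

/-- Only one intermediate point survives in the sum: it agrees with x on `T₁`, and with z elsewhere
because those coordinates lie in `T₂`. -/
theorem mul_apply_of_trivialAt {M₁ M₂ : Matrix (∀ i, α i) (∀ i, α i) ℂ} {T₁ T₂ : Finset ι}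
    (h₁ : ∀ j ∈ T₁, TrivialAt M₁ j) (h₂ : ∀ j ∈ T₂, TrivialAt M₂ j)
    (hT : ∀ i, i ∈ T₁ ∨ i ∈ T₂) (x z : ∀ i, α i) :
    (M₁ * M₂) x z = M₁ x (T₁.piecewise x z) * M₂ (T₁.piecewise x z) z := by
  rw [Matrix.mul_apply]
  refine Finset.sum_eq_single _ (fun y _ hy => ?_) fun h => absurd (Finset.mem_univ _) h
  obtain ⟨i, hi⟩ := Function.ne_iff.1 hy
  by_cases hi₁ : i ∈ T₁
  · rw [Finset.piecewise_eq_of_mem _ _ _ hi₁] at hi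
    rw [(h₁ i hi₁).1 _ _ hi.symm, zero_mul]
  · rw [Finset.piecewise_eq_of_notMem _ _ _ hi₁] at hi
    rw [(h₂ i ((hT i).resolve_left hi₁)).1 _ _ hi, mul_zero]

/-- Kernels acting nontrivially on disjoint sets of factors commute. -/
theorem mul_comm_of_trivialAt {M₁ M₂ : Matrix (∀ i, α i) (∀ i, α i) ℂ} {T₁ T₂ : Finset ι}
    (h₁ : ∀ j ∈ T₁, TrivialAt M₁ j) (h₂ : ∀ j ∈ T₂, TrivialAt M₂ j)
    (hT : ∀ i, i ∈ T₁ ∨ i ∈ T₂) : M₁ * M₂ = M₂ * M₁ := by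
  ext x z
  rw [mul_apply_of_trivialAt h₁ h₂ hT, mul_apply_of_trivialAt h₂ h₁ fun i => (hT i).symm]
  -- Where both kernels are trivial, both products vanish unless x and z agree. If they do agree,
  -- each factor may be shifted along its trivial coordinates to match the other order.
  by_cases hxz : ∀ i, i ∈ T₁ → i ∈ T₂ → x i = z i
  · have e₁ : M₁ (T₂.piecewise x z) z = M₁ x (T₁.piecewise x z) := by
      rw [← TrivialAt.piecewise_eq T₁ h₁ z x (T₁.piecewise x z)
        fun j hj => (Finset.piecewise_eq_of_mem _ _ _ hj).symm]
      congr 1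
      · ext1 i
        have := hxz i
        have := hT i
        simp only [Finset.piecewise]
        split_ifs <;> simp_all
      · ext1 i
        simp only [Finset.piecewise]
        split_ifs <;> rfl
    have e₂ : M₂ (T₁.piecewise x z) z = M₂ x (T₂.piecewise x z) := by
      rw [← TrivialAt.piecewise_eq T₂ h₂ x (T₁.piecewise x z) z fun j hj => by
        by_cases hj₁ : j ∈ T₁
        · rw [Finset.piecewise_eq_of_mem _ _ _ hj₁, hxz j hj₁ hj]
        · rw [Finset.piecewise_eq_of_notMem _ _ _ hj₁]]
      congr 1
      ext1 i
      have := hT i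
      simp only [Finset.piecewise]
      split_ifs <;> simp_all
    rw [e₁, e₂, mul_comm]
  · push Not at hxz
    obtain ⟨i, hi₁, hi₂, hi⟩ := hxz
    rw [(h₂ i hi₂).1 (T₁.piecewise x z) z (by rwa [Finset.piecewise_eq_of_mem _ _ _ hi₁]),
      (h₁ i hi₁).1 (T₂.piecewise x z) z (by rwa [Finset.piecewise_eq_of_mem _ _ _ hi₂]),
      mul_zero, mul_zero]

end ProductKernels

/-! ### Supports of superoperators -/

section Support

open Matrix

variable {N : ℕ} {d : Fin N → ℕ}

/-- Pairs of configurations as configurations of pairs. -/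
def pairConfigEquiv : (∀ i, Fin (d i) × Fin (d i)) ≃ FullConfig d × FullConfig d where
  toFun z := (fun i => (z i).1, fun i => (z i).2)
  invFun p := fun i => (p.1 i, p.2 i)
  left_inv _ := rfl
  right_inv _ := rfl

/-- The kernel of a superoperator. -/
def superKernel (K : Superop (FullConfig d)) :
    Matrix (∀ i, Fin (d i) × Fin (d i)) (∀ i, Fin (d i) × Fin (d i)) ℂ :=
  Matrix.of fun x y =>
    K (single (pairConfigEquiv y).1 (pairConfigEquiv y).2 1) (pairConfigEquiv x).1
      (pairConfigEquiv x).2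

theorem superKernel_mul (K₁ K₂ : Superop (FullConfig d)) :
    superKernel (K₁ * K₂) = superKernel K₁ * superKernel K₂ := by
  ext x z
  rw [mul_apply, ← pairConfigEquiv.symm.sum_comp, Fintype.sum_prod_type]
  simp only [superKernel, of_apply, Module.End.mul_apply, Equiv.apply_symm_apply]
  set X := K₂ (single (pairConfigEquiv z).1 (pairConfigEquiv z).2 1)
  conv_lhs => rw [matrix_eq_sum_single X]
  simp only [map_sum, Matrix.sum_apply]
  refine Finset.sum_congr rfl fun i _ => Finset.sum_congr rfl fun j _ => ?_
  have : single i j (X i j) = X i j • single i j (1 : ℂ) := by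
    rw [smul_single, smul_eq_mul, mul_one]
  rw [this, map_smul, Matrix.smul_apply, smul_eq_mul, mul_comm]

theorem superKernel_injective :
    Function.Injective (superKernel : Superop (FullConfig d) → _) := by
  intro K₁ K₂ h
  refine (Matrix.stdBasis ℂ (FullConfig d) (FullConfig d)).ext fun p => ?_
  rw [show p = (p.1, p.2) from rfl, stdBasis_eq_single]
  ext a b
  have := congrFun₂ h (pairConfigEquiv.symm (a, b)) (pairConfigEquiv.symm p)
  simpa [superKernel] using this

theorem tensorAt_single (S : Finset (Fin N)) (c e : FullConfig d) :
    tensorAt S (single (S.restrict c) (S.restrict e) 1) (single (Sᶜ.restrict c) (Sᶜ.restrict e) 1)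
      = single c e 1 := by
  have hres : ∀ a c : FullConfig d,
      (S.restrict c = S.restrict a ∧ Sᶜ.restrict c = Sᶜ.restrict a) ↔ c = a := by
    intro a c
    constructor
    · rintro ⟨h1, h2⟩
      ext1 i
      by_cases hi : i ∈ S
      · exact congrFun h1 ⟨i, hi⟩
      · exact congrFun h2 ⟨i, Finset.mem_compl.2 hi⟩
    · rintro rfl
      exact ⟨rfl, rfl⟩
  ext a b
  simp only [tensorAt, of_apply, single_apply, ← hres a c, ← hres b e, ← ite_and, mul_ite, mul_one,
    mul_zero]
  congr 1
  apply propext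
  tauto

theorem SuperopSupportedOn.trivialAt {K : Superop (FullConfig d)} {j : Fin N}
    (hK : SuperopSupportedOn K {j}ᶜ) : TrivialAt (superKernel K) j := by
  obtain ⟨K', hK'⟩ := hK
  have hker : ∀ x y, superKernel K x y = (K' (single (({j}ᶜ : Finset (Fin N)).restrict fun i => (y i).1)
      (({j}ᶜ : Finset (Fin N)).restrict fun i => (y i).2) 1)
        (({j}ᶜ : Finset (Fin N)).restrict fun i => (x i).1)
        (({j}ᶜ : Finset (Fin N)).restrict fun i => (x i).2)) * if x j = y j then 1 else 0 := by
    intro x y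
    rw [superKernel, of_apply, ← tensorAt_single ({j}ᶜ : Finset (Fin N)), hK', tensorAt, of_apply]
    congr 1
    rw [single_apply]
    congr 1
    have hj : ∀ a c : FullConfig d, (({j}ᶜᶜ : Finset (Fin N)).restrict a
        = ({j}ᶜᶜ : Finset (Fin N)).restrict c) ↔ a j = c j := by
      intro a c
      constructor
      · intro h
        exact congrFun h ⟨j, by simp⟩
      · intro h
        ext1 ⟨i, hi⟩
        obtain rfl : i = j := by simpa using hi
        exact h
    rw [hj, hj]
    apply propext
    rw [Prod.ext_iff]
    exact ⟨fun h => ⟨h.1.symm, h.2.symm⟩, fun h => ⟨h.1.symm, h.2.symm⟩⟩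
  refine ⟨fun x y h => by rw [hker, if_neg h, mul_zero], fun x y s h => ?_⟩
  have hu : ∀ (x : ∀ i, Fin (d i) × Fin (d i)),
      (({j}ᶜ : Finset (Fin N)).restrict (π := fun i => Fin (d i))
          fun i => (Function.update x j s i).1)
        = ({j}ᶜ : Finset (Fin N)).restrict fun i => (x i).1 := by
    intro x
    ext1 ⟨i, hi⟩
    have : i ≠ j := by simpa using hi
    simp [Finset.restrict, this]
  have hu' : ∀ (x : ∀ i, Fin (d i) × Fin (d i)),
      (({j}ᶜ : Finset (Fin N)).restrict (π := fun i => Fin (d i))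
          fun i => (Function.update x j s i).2)
        = ({j}ᶜ : Finset (Fin N)).restrict fun i => (x i).2 := by
    intro x
    ext1 ⟨i, hi⟩
    have : i ≠ j := by simpa using hi
    simp [Finset.restrict, this]
  rw [hker, hker, hu, hu, hu', hu', Function.update_self, Function.update_self, if_pos rfl,
    if_pos h]

/-- The support is defined one site at a time. Passing to kernels on pairs of configurations, which
is injective and multiplicative, turns this sitewise triviality into commutation. -/
theorem lie_eq_zero_of_disjoint_superopSupport {K₁ K₂ : Superop (FullConfig d)}
    (h : Disjoint (superopSupport K₁) (superopSupport K₂)) : ⁅K₁, K₂⁆ = 0 := by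
  have hK : ∀ K : Superop (FullConfig d), ∀ j ∈ (superopSupport K)ᶜ,
      TrivialAt (superKernel K) j := by
    intro K j hj
    have : SuperopSupportedOn K {j}ᶜ := by simpa [superopSupport] using hj
    exact this.trivialAt
  have := mul_comm_of_trivialAt (hK K₁) (hK K₂) fun i => by
    by_contra hc
    push Not at hc
    simp only [Finset.mem_compl, not_not] at hc
    exact Finset.disjoint_left.1 h hc.1 hc.2
  rw [← superKernel_mul, ← superKernel_mul] at this
  rw [Ring.lie_def, superKernel_injective this, sub_self]

/-- Splitting a configuration into the parts inside and outside `S`. -/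
def splitConfigEquiv (S : Finset (Fin N)) : FullConfig d ≃ Config d S × Config d Sᶜ where
  toFun a := (S.restrict a, Sᶜ.restrict a)
  invFun p := fun i => if h : i ∈ S then p.1 ⟨i, h⟩ else p.2 ⟨i, Finset.mem_compl.2 h⟩
  left_inv a := by ext1 i; simp [Finset.restrict]
  right_inv p := by
    ext1
    · ext1 ⟨i, hi⟩; simp [Finset.restrict, hi]
    · ext1 ⟨i, hi⟩
      have : i ∉ S := Finset.mem_compl.1 hi
      simp [Finset.restrict, this]

open scoped Kronecker in
theorem tensorAt_eq_submatrix (S : Finset (Fin N)) (X : Matrix (Config d S) (Config d S) ℂ)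
    (Y : Matrix (Config d Sᶜ) (Config d Sᶜ) ℂ) :
    tensorAt S X Y = (X ⊗ₖ Y).submatrix (splitConfigEquiv S) (splitConfigEquiv S) := rfl

theorem tensorAt_mul (S : Finset (Fin N)) (X X' : Matrix (Config d S) (Config d S) ℂ)
    (Y Y' : Matrix (Config d Sᶜ) (Config d Sᶜ) ℂ) :
    tensorAt S X Y * tensorAt S X' Y' = tensorAt S (X * X') (Y * Y') := by
  rw [tensorAt_eq_submatrix, tensorAt_eq_submatrix, tensorAt_eq_submatrix, submatrix_mul_equiv,
    mul_kronecker_mul]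

theorem tensorAt_one_one (S : Finset (Fin N)) : tensorAt S (1 : Matrix (Config d S) _ ℂ) 1 = 1 := by
  rw [tensorAt_eq_submatrix, one_kronecker_one, submatrix_one_equiv]

namespace OpSupportedOn

variable {S T : Finset (Fin N)} {A B : Matrix (FullConfig d) (FullConfig d) ℂ}

theorem one (S : Finset (Fin N)) : OpSupportedOn (1 : Matrix (FullConfig d) (FullConfig d) ℂ) S :=
  ⟨1, (tensorAt_one_one S).symm⟩

theorem mul (hA : OpSupportedOn A S) (hB : OpSupportedOn B S) : OpSupportedOn (A * B) S := by
  obtain ⟨A', rfl⟩ := hA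
  obtain ⟨B', rfl⟩ := hB
  exact ⟨A' * B', by rw [tensorAt_mul, one_mul]⟩

theorem conjTranspose (hA : OpSupportedOn A S) : OpSupportedOn Aᴴ S := by
  obtain ⟨A', rfl⟩ := hA
  exact ⟨A'ᴴ, by rw [tensorAt_eq_submatrix, tensorAt_eq_submatrix, conjTranspose_submatrix,
    conjTranspose_kronecker, conjTranspose_one]⟩

theorem mono (hA : OpSupportedOn A S) (hST : S ⊆ T) : OpSupportedOn A T := by
  obtain ⟨A', rfl⟩ := hA
  classical
  refine ⟨Matrix.of fun x y => A' (fun i => x ⟨i, hST i.2⟩) (fun i => y ⟨i, hST i.2⟩) *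
    if ∀ i : T, (i : Fin N) ∉ S → x i = y i then 1 else 0, ?_⟩
  ext a b
  simp only [tensorAt, of_apply, one_apply, mul_assoc]
  congr 1
  rw [ite_zero_mul_ite_zero, mul_one]
  congr 1
  apply propext
  constructor
  · intro h
    refine ⟨fun i hi => congrFun h ⟨i, Finset.mem_compl.2 hi⟩, ?_⟩
    ext1 ⟨i, hi⟩
    exact congrFun h ⟨i, Finset.mem_compl.2 fun hiS => Finset.mem_compl.1 hi (hST hiS)⟩
  · rintro ⟨h1, h2⟩
    ext1 ⟨i, hi⟩
    by_cases hiT : i ∈ T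
    · exact h1 ⟨i, hiT⟩ (Finset.mem_compl.1 hi)
    · exact congrFun h2 ⟨i, Finset.mem_compl.2 hiT⟩

end OpSupportedOn

theorem tensorAt_add (S : Finset (Fin N)) (X X' : Matrix (Config d S) (Config d S) ℂ)
    (Y : Matrix (Config d Sᶜ) (Config d Sᶜ) ℂ) :
    tensorAt S (X + X') Y = tensorAt S X Y + tensorAt S X' Y := by
  ext a b; simp [tensorAt, add_mul]

theorem tensorAt_smul (S : Finset (Fin N)) (c : ℂ) (X : Matrix (Config d S) (Config d S) ℂ)
    (Y : Matrix (Config d Sᶜ) (Config d Sᶜ) ℂ) :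
    tensorAt S (c • X) Y = c • tensorAt S X Y := by
  ext a b; simp [tensorAt, mul_assoc]

namespace SuperopSupportedOn

variable {S : Finset (Fin N)} {K K₁ K₂ : Superop (FullConfig d)}
  {A B : Matrix (FullConfig d) (FullConfig d) ℂ}

theorem add (h₁ : SuperopSupportedOn K₁ S) (h₂ : SuperopSupportedOn K₂ S) :
    SuperopSupportedOn (K₁ + K₂) S := by
  obtain ⟨K₁', h₁⟩ := h₁
  obtain ⟨K₂', h₂⟩ := h₂
  exact ⟨K₁' + K₂', fun X Y => by
    rw [LinearMap.add_apply, h₁, h₂, LinearMap.add_apply, tensorAt_add]⟩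

theorem smul (c : ℂ) (h : SuperopSupportedOn K S) : SuperopSupportedOn (c • K) S := by
  obtain ⟨K', h⟩ := h
  exact ⟨c • K', fun X Y => by rw [LinearMap.smul_apply, h, LinearMap.smul_apply, tensorAt_smul]⟩

theorem sub (h₁ : SuperopSupportedOn K₁ S) (h₂ : SuperopSupportedOn K₂ S) :
    SuperopSupportedOn (K₁ - K₂) S := by
  have e : K₁ - K₂ = K₁ + (-1 : ℂ) • K₂ := by module
  rw [e]
  exact h₁.add (h₂.smul (-1))

theorem sandwich (hA : OpSupportedOn A S) (hB : OpSupportedOn B S) :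
    SuperopSupportedOn (sandwich A B) S := by
  obtain ⟨A', rfl⟩ := hA
  obtain ⟨B', rfl⟩ := hB
  exact ⟨_root_.sandwich A' B', fun X Y => by
    rw [sandwich_apply, sandwich_apply, tensorAt_mul, tensorAt_mul, one_mul, mul_one]⟩

theorem coherentTerm (hA : OpSupportedOn A S) : SuperopSupportedOn (coherentTerm A) S :=
  ((sandwich hA (.one S)).sub (sandwich (.one S) hA)).smul _

theorem crossDissipator (hA : OpSupportedOn A S) (hB : OpSupportedOn B S) :
    SuperopSupportedOn (crossDissipator A B) S :=
  (sandwich hA hB.conjTranspose).sub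
    (((sandwich (hB.conjTranspose.mul hA) (.one S)).add
      (sandwich (.one S) (hB.conjTranspose.mul hA))).smul _)

end SuperopSupportedOn

theorem superopSupport_subset {K : Superop (FullConfig d)} {S : Finset (Fin N)}
    (h : ∀ T, S ⊆ T → SuperopSupportedOn K T) : superopSupport K ⊆ S := by
  intro j hj
  by_contra hjS
  have hj' : ¬ SuperopSupportedOn K {j}ᶜ := by simpa [superopSupport] using hj
  refine hj' (h _ fun i hi => ?_)
  simp only [Finset.mem_compl, Finset.mem_singleton]
  rintro rfl
  exact hjS hi

/-- The factor 2 comes from the cross terms, which involve two components of a jump operator. -/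
theorem LocalLindbladian.card_superopSupport_localTerm_le {Γ k : ℕ}
    (𝓛 : LocalLindbladian N d Γ k) (v : Fin 𝓛.mC ⊕ (Fin 𝓛.mD × Fin Γ × Fin Γ)) :
    (superopSupport (𝓛.localTerm v)).card ≤ 2 * k := by
  rcases v with μ | ⟨ν, γ₁, γ₂⟩
  · obtain ⟨S, hS, h⟩ := 𝓛.local_H μ
    have : superopSupport (𝓛.localTerm (.inl μ)) ⊆ S :=
      superopSupport_subset fun T hT => .coherentTerm (h.mono hT)
    exact (Finset.card_le_card this).trans (by omega)
  · obtain ⟨S₁, hS₁, h₁⟩ := 𝓛.local_comp ν γ₁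
    obtain ⟨S₂, hS₂, h₂⟩ := 𝓛.local_comp ν γ₂
    have : superopSupport (𝓛.localTerm (.inr (ν, γ₁, γ₂))) ⊆ S₁ ∪ S₂ :=
      superopSupport_subset fun T hT => .crossDissipator
        (h₁.mono (Finset.subset_union_left.trans hT)) (h₂.mono (Finset.subset_union_right.trans hT))
    have h := (Finset.card_le_card this).trans (Finset.card_union_le _ _)
    omega

end Support

end

/-! ### Counting nested commutators of extensive families -/

section Counting

theorem norm_lie_le {A : Type*} [NormedRing A] (x y : A) : ‖⁅x, y⁆‖ ≤ 2 * (‖x‖ * ‖y‖) := by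
  rw [Ring.lie_def]
  have := norm_sub_le (x * y) (y * x)
  have := norm_mul_le x y
  have := norm_mul_le y x
  linarith

variable {V ι : Type*} [Fintype V] [DecidableEq ι]

/-- The weight of the sets meeting `T` is at most `g` per site of `T`. -/
theorem sum_le_card_mul_of_extensive {s : V → Finset ι} {w : V → ℝ} (hw : ∀ v, 0 ≤ w v) {g : ℝ}
    (hg : ∀ j, ∑ v with j ∈ s v, w v ≤ g) (T : Finset ι) (f : V → ℝ) (hf : ∀ v, f v ≤ w v)
    (hf0 : ∀ v, Disjoint (s v) T → f v = 0) : ∑ v, f v ≤ T.card * g := by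
  calc ∑ v, f v ≤ ∑ v, ∑ j ∈ T, if j ∈ s v then w v else 0 := by
        refine Finset.sum_le_sum fun v _ => ?_
        have hnn : ∀ j ∈ T, 0 ≤ if j ∈ s v then w v else 0 := fun j _ => by
          split_ifs <;> simp [hw]
        by_cases h : Disjoint (s v) T
        · rw [hf0 v h]
          exact Finset.sum_nonneg hnn
        · obtain ⟨j, hj, hjT⟩ := Finset.not_disjoint_iff.1 h
          refine (hf v).trans ?_
          have := Finset.single_le_sum hnn hjT
          rwa [if_pos hj] at this
    _ = ∑ j ∈ T, ∑ v with j ∈ s v, w v := by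
        rw [Finset.sum_comm]
        simp only [Finset.sum_filter]
    _ ≤ ∑ _j ∈ T, g := Finset.sum_le_sum fun j _ => hg j
    _ = T.card * g := by simp

/-- Sum over u first: it must meet `s v ∪ s w`, at most 2κ sites. Then v must meet `s w`, at most κ
sites, and finally w ranges over the whole lattice. The two commutators contribute the remaining
factor 4 of the constant 8. -/
theorem sum_nestedCommutator_le {A : Type*} [NormedRing A] [Fintype ι] {s : V → Finset ι}
    {x : V → A} {g : ℝ} (hg0 : 0 ≤ g) {κ : ℕ} (hκ : ∀ v, (s v).card ≤ κ)
    (hg : ∀ j, ∑ v with j ∈ s v, ‖x v‖ ≤ g)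
    (hx : ∀ u v, Disjoint (s u) (s v) → ⁅x u, x v⁆ = 0) :
    ∑ u, ∑ v, ∑ w, ‖⁅x u, ⁅x v, x w⁆⁆‖ ≤ 8 * Fintype.card ι * κ ^ 2 * g ^ 3 := by
  have hn : ∀ v, 0 ≤ ‖x v‖ := fun v => norm_nonneg _
  have lie0 : ∀ a : A, ⁅a, (0 : A)⁆ = 0 := fun a => by simp [Ring.lie_def]
  have h1 : ∀ v w, ∑ u, ‖⁅x u, ⁅x v, x w⁆⁆‖ ≤ (2 * κ * g) * (4 * (‖x v‖ * ‖x w‖)) := by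
    intro v w
    have hb : ∀ u, ‖⁅x u, ⁅x v, x w⁆⁆‖ ≤ ‖x u‖ * (4 * (‖x v‖ * ‖x w‖)) := fun u => by
      have a1 := norm_lie_le (x u) ⁅x v, x w⁆
      have a2 := mul_le_mul_of_nonneg_left (norm_lie_le (x v) (x w)) (hn u)
      linarith
    have hv : ∀ u, Disjoint (s u) (s v ∪ s w) → ⁅x u, ⁅x v, x w⁆⁆ = 0 := fun u hu => by
      rw [Finset.disjoint_union_right] at hu
      have c1 : Commute (x u) (x v) := sub_eq_zero.1 (hx u v hu.1)
      have c2 : Commute (x u) (x w) := sub_eq_zero.1 (hx u w hu.2)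
      exact sub_eq_zero.2 ((c1.mul_right c2).sub_right (c2.mul_right c1))
    have hsum : ∑ u, (if Disjoint (s u) (s v ∪ s w) then 0 else ‖x u‖) ≤ 2 * κ * g := by
      refine (sum_le_card_mul_of_extensive hn hg (s v ∪ s w) _ (fun u => ?_)
        fun u hu => if_pos hu).trans ?_
      · split_ifs <;> simp
      · have hc : ((s v ∪ s w).card : ℝ) ≤ 2 * κ := by
          have := Finset.card_union_le (s v) (s w)
          have := hκ v
          have := hκ w
          exact_mod_cast (by omega : (s v ∪ s w).card ≤ 2 * κ)
        gcongr
    calc ∑ u, ‖⁅x u, ⁅x v, x w⁆⁆‖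
        ≤ ∑ u, (if Disjoint (s u) (s v ∪ s w) then 0 else ‖x u‖) * (4 * (‖x v‖ * ‖x w‖)) := by
          refine Finset.sum_le_sum fun u _ => ?_
          split_ifs with h
          · simp [hv u h]
          · exact hb u
      _ ≤ _ := by
          rw [← Finset.sum_mul]
          gcongr
  have h2 : ∀ w, ∑ v, ∑ u, ‖⁅x u, ⁅x v, x w⁆⁆‖ ≤ (κ * g) * (8 * κ * g * ‖x w‖) := by
    intro w
    have hsum : ∑ v, (if Disjoint (s v) (s w) then 0 else ‖x v‖) ≤ κ * g := by
      refine (sum_le_card_mul_of_extensive hn hg (s w) _ (fun u => ?_)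
        fun u hu => if_pos hu).trans ?_
      · split_ifs <;> simp
      · gcongr
        exact hκ w
    calc ∑ v, ∑ u, ‖⁅x u, ⁅x v, x w⁆⁆‖
        ≤ ∑ v, (if Disjoint (s v) (s w) then 0 else ‖x v‖) * (8 * κ * g * ‖x w‖) := by
          refine Finset.sum_le_sum fun v _ => ?_
          split_ifs with h
          · simp [hx v w h, lie0]
          · exact (h1 v w).trans_eq (by ring)
      _ ≤ _ := by
          rw [← Finset.sum_mul]
          gcongr
  have h3 : ∑ w, (if Disjoint (s w) Finset.univ then 0 else ‖x w‖) ≤ Fintype.card ι * g :=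
    sum_le_card_mul_of_extensive hn hg Finset.univ _ (fun u => by split_ifs <;> simp)
      fun u hu => if_pos hu
  calc ∑ u, ∑ v, ∑ w, ‖⁅x u, ⁅x v, x w⁆⁆‖ = ∑ w, ∑ v, ∑ u, ‖⁅x u, ⁅x v, x w⁆⁆‖ := by
        rw [Finset.sum_comm]
        simp_rw [Finset.sum_comm (s := Finset.univ (α := V)) (t := Finset.univ (α := V))
          (f := fun u w => ‖⁅x u, ⁅x _, x w⁆⁆‖)]
        rw [Finset.sum_comm]
    _ ≤ ∑ w, (if Disjoint (s w) Finset.univ then 0 else ‖x w‖) * (8 * κ ^ 2 * g ^ 2) := by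
        refine Finset.sum_le_sum fun w _ => ?_
        split_ifs with h
        -- Extensivity does not control an element with empty support, but such an element commutes
        -- with all others and contributes nothing.
        · have h0 : ∀ v, ⁅x v, x w⁆ = 0 := fun v => by
            refine hx v w ?_
            have : s w = ∅ := by simpa using h.eq_bot_of_le (Finset.subset_univ _)
            simp [this]
          simp [h0, lie0]
        · exact (h2 w).trans_eq (by ring)
    _ ≤ (Fintype.card ι * g) * (8 * κ ^ 2 * g ^ 2) := by
        rw [← Finset.sum_mul]
        gcongr
    _ = _ := by ring

theorem sum_le_sum_of_fiberwise {V P A : Type*} [Fintype V] [Fintype P] [DecidableEq P]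
    [AddCommMonoid A] (π : V → P) (x : V → A) (F : A → ℝ) (hF0 : F 0 = 0)
    (hF : ∀ a b, F (a + b) ≤ F a + F b) :
    ∑ p, F (∑ v with π v = p, x v) ≤ ∑ v, F (x v) := by
  rw [← Finset.sum_fiberwise Finset.univ π fun v => F (x v)]
  refine Finset.sum_le_sum fun p _ => ?_
  exact Finset.le_sum_of_subadditive (N := ℝ) F hF0.le hF (Finset.univ.filter fun v => π v = p) x

/-- Subadditivity is applied in one slot at a time. This passes from the Trotter summands, which
need not be local, to their local pieces. -/
theorem sum_nestedCommutator_fiberwise_le {V P A : Type*} [Fintype V] [Fintype P] [DecidableEq P]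
    [NormedRing A] (π : V → P) (x : V → A) (y : P → A)
    (hy : ∀ p, y p = ∑ v with π v = p, x v) :
    ∑ p, ∑ q, ∑ r, ‖⁅y p, ⁅y q, y r⁆⁆‖ ≤ ∑ u, ∑ v, ∑ w, ‖⁅x u, ⁅x v, x w⁆⁆‖ := by
  have add_lie' : ∀ a b c : A, ⁅a + b, c⁆ = ⁅a, c⁆ + ⁅b, c⁆ := fun a b c => by
    simp only [Ring.lie_def]; noncomm_ring
  have lie_add' : ∀ a b c : A, ⁅c, a + b⁆ = ⁅c, a⁆ + ⁅c, b⁆ := fun a b c => by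
    simp only [Ring.lie_def]; noncomm_ring
  have lie0 : ∀ a : A, ⁅a, (0 : A)⁆ = 0 := fun a => by simp [Ring.lie_def]
  have zlie : ∀ a : A, ⁅(0 : A), a⁆ = 0 := fun a => by simp [Ring.lie_def]
  calc ∑ p, ∑ q, ∑ r, ‖⁅y p, ⁅y q, y r⁆⁆‖ ≤ ∑ p, ∑ q, ∑ w, ‖⁅y p, ⁅y q, x w⁆⁆‖ := by
        refine Finset.sum_le_sum fun p _ => Finset.sum_le_sum fun q _ => ?_
        simp only [hy (_ : P)]
        exact sum_le_sum_of_fiberwise π x (fun a => ‖⁅∑ v with π v = p, x v,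
          ⁅∑ v with π v = q, x v, a⁆⁆‖) (by simp [lie0])
          fun a b => by simpa only [lie_add'] using norm_add_le _ _
    _ ≤ ∑ p, ∑ v, ∑ w, ‖⁅y p, ⁅x v, x w⁆⁆‖ := by
        refine Finset.sum_le_sum fun p _ => ?_
        simp only [hy (_ : P)]
        refine sum_le_sum_of_fiberwise π x (fun a => ∑ w, ‖⁅∑ v with π v = p, x v, ⁅a, x w⁆⁆‖)
          (by simp [lie0, zlie]) fun a b => ?_
        simp only [← Finset.sum_add_distrib, add_lie', lie_add']
        exact Finset.sum_le_sum fun w _ => norm_add_le _ _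
    _ ≤ ∑ u, ∑ v, ∑ w, ‖⁅x u, ⁅x v, x w⁆⁆‖ := by
        simp only [hy (_ : P)]
        refine sum_le_sum_of_fiberwise π x (fun a => ∑ v, ∑ w, ‖⁅a, ⁅x v, x w⁆⁆‖)
          (by simp [zlie]) fun a b => ?_
        simp only [← Finset.sum_add_distrib, add_lie']
        exact Finset.sum_le_sum fun v _ => Finset.sum_le_sum fun w _ => norm_add_le _ _

end Counting

/-! ### Local Lindbladians and the final constants -/

section Main

open Matrix

variable {n : Type} [Fintype n] [DecidableEq n]

theorem crossDissipator_sum_left {ι : Type*} (s : Finset ι) (A : ι → Matrix n n ℂ)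
    (B : Matrix n n ℂ) : crossDissipator (∑ i ∈ s, A i) B = ∑ i ∈ s, crossDissipator (A i) B := by
  ext1 X
  simp only [crossDissipator, LinearMap.sub_apply, LinearMap.add_apply, LinearMap.smul_apply,
    LinearMap.sum_apply, sandwich_apply, Finset.sum_mul, Finset.mul_sum, Finset.sum_sub_distrib,
    Finset.sum_add_distrib, Finset.smul_sum, smul_add]

theorem crossDissipator_sum_right {ι : Type*} (s : Finset ι) (A : Matrix n n ℂ)
    (B : ι → Matrix n n ℂ) :
    crossDissipator A (∑ i ∈ s, B i) = ∑ i ∈ s, crossDissipator A (B i) := by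
  ext1 X
  simp only [crossDissipator, LinearMap.sub_apply, LinearMap.add_apply, LinearMap.smul_apply,
    LinearMap.sum_apply, sandwich_apply, Finset.sum_mul, Finset.mul_sum, Finset.sum_sub_distrib,
    Finset.sum_add_distrib, Finset.smul_sum, smul_add, conjTranspose_sum]

namespace LocalLindbladian

variable {N : ℕ} {d : Fin N → ℕ} {Γ k : ℕ} (𝓛 : LocalLindbladian N d Γ k)

/-- The summand of the Trotter decomposition to which a local superoperator belongs. -/
def parent : Fin 𝓛.mC ⊕ (Fin 𝓛.mD × Fin Γ × Fin Γ) → Fin 𝓛.mC ⊕ Fin 𝓛.mD :=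
  Sum.map id Prod.fst

theorem term_eq_sum_localTerm (p : Fin 𝓛.mC ⊕ Fin 𝓛.mD) :
    𝓛.term p = ∑ v with 𝓛.parent v = p, 𝓛.localTerm v := by
  rw [Finset.sum_filter, Fintype.sum_sum_type]
  rcases p with μ | ν
  · simp [parent, term, localTerm]
  · simp only [parent, term, localTerm, Sum.map_inl, Sum.map_inr, reduceCtorEq, if_false,
      Finset.sum_const_zero, zero_add, Sum.inr.injEq, Fintype.sum_prod_type, jump, dissipator,
      crossDissipator_sum_left, crossDissipator_sum_right]
    rw [Finset.sum_eq_single ν]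
    · simpa using Finset.sum_comm
    · intro b _ hb
      simp [hb]
    · simp

theorem isLindbladian_term (p : Fin 𝓛.mC ⊕ Fin 𝓛.mD) : IsLindbladian (𝓛.term p) := by
  rcases p with μ | ν
  · exact isLindbladian_coherentTerm (𝓛.isHermitian_H μ)
  · exact isLindbladian_dissipator (𝓛.jump ν)

theorem diamondNorm_nonneg (Φ : Superop n) : 0 ≤ diamondNorm Φ := by
  rw [← norm_diamondHom]
  exact norm_nonneg _

variable {𝓛} in
theorem IsExtensive.nonneg {g : ℝ} (hg : 𝓛.IsExtensive g) (j : Fin N) : 0 ≤ g :=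
  (Finset.sum_nonneg fun _ _ => diamondNorm_nonneg _).trans (hg j)

variable {𝓛} in
theorem IsExtensive.alphaComm3_le {g : ℝ} (hg : 𝓛.IsExtensive g) (hg0 : 0 ≤ g)
    {m : ℕ} (e : Fin m ≃ Fin 𝓛.mC ⊕ Fin 𝓛.mD) :
    alphaComm3 (fun j => 𝓛.term (e j)) ≤ 32 * N * k ^ 2 * g ^ 3 := by
  have h1 : alphaComm3 (fun j => 𝓛.term (e j))
      = ∑ p, ∑ q, ∑ r, ‖⁅diamondHom (𝓛.term p), ⁅diamondHom (𝓛.term q),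
          diamondHom (𝓛.term r)⁆⁆‖ := by
    rw [alphaComm3_eq, nestedCommutatorSum, ← e.sum_comp]
    refine Finset.sum_congr rfl fun i _ => ?_
    rw [← e.sum_comp]
    refine Finset.sum_congr rfl fun j _ => ?_
    rw [← e.sum_comp]
  rw [h1]
  refine (sum_nestedCommutator_fiberwise_le 𝓛.parent (fun v => diamondHom (𝓛.localTerm v)) _
    fun p => by rw [term_eq_sum_localTerm, map_sum]).trans ?_
  refine (sum_nestedCommutator_le (s := fun v => superopSupport (𝓛.localTerm v)) hg0
    𝓛.card_superopSupport_localTerm_le (fun j => by simpa only [norm_diamondHom] using hg j)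
    fun u v huv => ?_).trans_eq ?_
  · rw [← map_lie_of_algHom, lie_eq_zero_of_disjoint_superopSupport huv, map_zero]
  · rw [Fintype.card_fin]; push_cast; ring

variable {𝓛} in
theorem IsExtensive.sqrt_alphaComm3_mul_le {g : ℝ} (hg : 𝓛.IsExtensive g) {m : ℕ}
    (e : Fin m ≃ Fin 𝓛.mC ⊕ Fin 𝓛.mD) {t : ℝ} (ht : 0 < t) :
    √(alphaComm3 fun j => 𝓛.term (e j)) * t ^ (3 / 2 : ℝ)
      ≤ 6 * (√(N : ℝ) * k * (g * t) ^ (3 / 2 : ℝ)) := by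
  -- Without sites g may be negative, but extensivity then holds vacuously with constant 0, which
  -- forces the commutator sum to vanish.
  rcases Nat.eq_zero_or_pos N with rfl | hN
  · have h0 : 𝓛.IsExtensive 0 := fun j => j.elim0
    have := h0.alphaComm3_le le_rfl e
    rw [Real.sqrt_eq_zero_of_nonpos (by simpa using this)]
    simp
  · have hg0 : 0 ≤ g := hg.nonneg ⟨0, hN⟩
    have hg3 : (g ^ (3 / 2 : ℝ)) ^ 2 = g ^ 3 := by
      rw [← Real.rpow_natCast, ← Real.rpow_mul hg0, ← Real.rpow_natCast]; norm_num
    -- The constant 6 is an integer upper bound for `√32`, where 32 is 8 times the square of the 2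
    -- in the support bound `2 * k`.
    have h : √(alphaComm3 fun j => 𝓛.term (e j)) ≤ 6 * (√(N : ℝ) * k * g ^ (3 / 2 : ℝ)) := by
      refine Real.sqrt_le_iff.2 ⟨by positivity, (hg.alphaComm3_le hg0 e).trans ?_⟩
      rw [mul_pow, mul_pow, mul_pow, hg3, Real.sq_sqrt (Nat.cast_nonneg N)]
      have : (0 : ℝ) ≤ N * k ^ 2 * g ^ 3 := by positivity
      linarith
    rw [Real.mul_rpow hg0 ht.le]
    calc _ ≤ 6 * (√(N : ℝ) * k * g ^ (3 / 2 : ℝ)) * t ^ (3 / 2 : ℝ) := by gcongr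
      _ = _ := by ring

end LocalLindbladian

end Main

theorem theorem1 :
    (∃ C : ℝ, 0 < C ∧
      ∀ (n : Type) [Fintype n] [DecidableEq n] (m : ℕ) (L : Fin m → Superop n),
        (∀ j, IsLindbladian (L j)) →
        ∀ t ε : ℝ, 0 < t → 0 < ε →
          ∃ r₀ : ℕ, 1 ≤ r₀ ∧
            (r₀ : ℝ) ≤ max 1 (C * (√(alphaComm3 L) * t ^ (3 / 2 : ℝ) / √ε)) ∧
            ∀ r : ℕ, r₀ ≤ r → trotterError L t r ≤ ε) ∧
    (∃ C : ℝ, 0 < C ∧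
      ∀ (N : ℕ) (d : Fin N → ℕ) (Γ k : ℕ) (𝓛 : LocalLindbladian N d Γ k) (g : ℝ),
        𝓛.IsExtensive g →
        ∀ (e : Fin (𝓛.mC + 𝓛.mD) ≃ Fin 𝓛.mC ⊕ Fin 𝓛.mD) (t ε : ℝ), 0 < t → 0 < ε →
          ∃ r₀ : ℕ, 1 ≤ r₀ ∧
            (r₀ : ℝ) ≤ max 1 (C * (√(N : ℝ) * k * (g * t) ^ (3 / 2 : ℝ) / √ε)) ∧
            ∀ r : ℕ, r₀ ≤ r → trotterError (fun j => 𝓛.term (e j)) t r ≤ ε) := by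
  -- In the local case 12 = 2 · 6 combines the rounding constant with the bound for `√32`.
  refine ⟨⟨2, two_pos, fun n _ _ m L hL t ε ht hε => exists_trotter_steps L hL ht hε⟩,
    12, by norm_num, fun N d Γ k 𝓛 g hg e t ε ht hε => ?_⟩
  obtain ⟨r₀, h1, h2, h3⟩ := exists_trotter_steps (fun j => 𝓛.term (e j))
    (fun j => 𝓛.isLindbladian_term (e j)) ht hε
  refine ⟨r₀, h1, h2.trans (max_le_max le_rfl ?_), h3⟩
  calc _ ≤ 2 * (6 * (√(N : ℝ) * k * (g * t) ^ (3 / 2 : ℝ)) / √ε) := by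
        have := hg.sqrt_alphaComm3_mul_le e ht
        exact mul_le_mul_of_nonneg_left (div_le_div_of_nonneg_right this (Real.sqrt_nonneg _))
          two_pos.le
    _ = _ := by ring
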